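/- Let $M$ be a compact smooth three-manifold (without boundary), $\kappa\in\mathbb{R}$, $g$ a smooth Riemannian metric on $M$ and $\phi\in C^\infty(M)$. Write $\mathcal{R}^g_{v_1,v_2}v_3=\nabla^g_{v_1}\nabla^g_{v_2}v_3-\nabla^g_{v_2}\nabla^g_{v_1}v_3-\nabla^g_{[v_1,v_2]}v_3$ for the Riemann tensor of $g$, $\mathcal{R}^g_{v_1,v_2}(v_3,v_4)=g(\mathcal{R}^g_{v_1,v_2}v_3,v_4)$, and, in a local orthonormal frame $(e_i)$, $\mathrm{Ric}^g(v_1,v_2)=\sum_i\mathcal{R}^g_{e_i,v_1}(v_2,e_i)$, $s_g=\mathrm{tr}_g\mathrm{Ric}^g$, $$(\mathcal{R}^g\circ_g\mathcal{R}^g)(v_1,v_2)=\tfrac12\sum_{i,j,k}\mathcal{R}^g_{v_1,e_i}(e_j,e_k)\,\mathcal{R}^g_{v_2,e_i}(e_j,e_k),\qquad |\mathcal{R}^g|_g^2=\tfrac14\sum_{i,j,k,l}\mathcal{R}^g_{e_i,e_j}(e_k,e_l)^2,$$ $$(\mathrm{d}_{\nabla^g}^{*}\mathcal{R}^g)(v_1,v_2,v_3)=-\sum_i(\nabla^g_{e_i}\mathcal{R}^g)(e_i,v_1,v_2,v_3),\qquad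 \delta^g\mathrm{d}\phi=-\mathrm{tr}_g\nabla^g\mathrm{d}\phi .$$ Suppose that $g$ is not flat (its Riemann tensor does not vanish identically) and that $(g,\phi)$ is a Heterotic soliton with vanishing torsion, that is, $$\mathrm{Ric}^g+\nabla^g\mathrm{d}\phi-\tfrac12e^{2\phi}g+\kappa\,\mathcal{R}^g\circ_g\mathcal{R}^g=0,$$ $$\mathrm{d}_{\nabla^g}^{*}\mathcal{R}^g+\mathcal{R}^g(\mathrm{d}\phi,\cdot,\cdot,\cdot)=0,$$ $$\delta^g\mathrm{d}\phi+|\mathrm{d}\phi|_g^2-e^{2\phi}+\kappa\,|\mathcal{R}^g|_g^2=0 .$$ Then the dilaton $\phi$ is constant if and only if $g$ is hyperbolic, i.e. has constant negative sectional curvature. In that case $g$ is Einstein, $\kappa s_g=-24$ and $\kappa e^{2\phi}=48$ on $M$; and $(M,g)$ is not, near any of its points, isometric to a Riemannian product of an interval and a surface. -/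

import Mathlib

open scoped Manifold ContDiff

noncomputable section

namespace Heterotic

/-- The model space of three-manifolds. -/
abbrev E3 : Type := EuclideanSpace ℝ (Fin 3)

/-- The `i`-th standard basis vector of `ℝ³`. -/
def basisVec (i : Fin 3) : E3 := EuclideanSpace.single i (1 : ℝ)

/-- The `i`-th partial derivative of a function on (an open subset of) `ℝ³`. -/
def pd (i : Fin 3) (f : E3 → ℝ) (x : E3) : ℝ := fderiv ℝ f x (basisVec i)

/-! ### Tensor calculus in a coordinate domain

Here `G` is the matrix-valued function of the components `g_{ij} = g(∂_i, ∂_j)` of a Riemannian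
metric in coordinates, and `f` is a function written in the same coordinates. -/

section Coordinates

variable (G : E3 → Matrix (Fin 3) (Fin 3) ℝ) (f : E3 → ℝ)

/-- The components `g^{ij}` of the inverse metric. -/
def inv (i j : Fin 3) (x : E3) : ℝ := (G x)⁻¹ i j

/-- The Christoffel symbols `Γ^k_{ij}` of the Levi-Civita connection:
`∇_{∂_i} ∂_j = ∑ k, Γ^k_{ij} ∂_k`. -/
def christoffel (k i j : Fin 3) (x : E3) : ℝ :=
  (1 / 2) * ∑ l, inv G k l x *
    (pd i (fun y => G y j l) x + pd j (fun y => G y i l) x - pd l (fun y => G y i j) x)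

/-- The component of `R(∂_i, ∂_j) ∂_k` along `∂_l`, for the curvature
`R(v₁, v₂) v₃ = ∇_{v₁} ∇_{v₂} v₃ - ∇_{v₂} ∇_{v₁} v₃ - ∇_{[v₁, v₂]} v₃`. -/
def riemannUp (l i j k : Fin 3) (x : E3) : ℝ :=
  pd i (christoffel G l j k) x - pd j (christoffel G l i k) x
    + ∑ m, (christoffel G l i m x * christoffel G m j k x
          - christoffel G l j m x * christoffel G m i k x)

/-- The Riemann tensor `R_{ijkl} = R_{∂_i, ∂_j}(∂_k, ∂_l) = g(R(∂_i, ∂_j) ∂_k, ∂_l)`. -/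
def riemann (i j k l : Fin 3) (x : E3) : ℝ :=
  ∑ m, G x l m * riemannUp G m i j k x

/-- The Ricci tensor `Ric(v₁, v₂) = ∑ i, R_{e_i, v₁}(v₂, e_i)`. -/
def ricci (j k : Fin 3) (x : E3) : ℝ :=
  ∑ a, ∑ b, inv G a b x * riemann G a j k b x

/-- The scalar curvature `s_g = tr_g Ric`. -/
def scalarCurvature (x : E3) : ℝ :=
  ∑ a, ∑ b, inv G a b x * ricci G a b x

/-- The contraction `(R ∘ R)(v₁, v₂) = ½ ∑ i j k, R_{v₁, e_i}(e_j, e_k) R_{v₂, e_i}(e_j, e_k)`. -/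
def riemannSquare (a b : Fin 3) (x : E3) : ℝ :=
  (1 / 2) * ∑ i, ∑ j, ∑ k, ∑ p, ∑ q, ∑ r,
    inv G i p x * inv G j q x * inv G k r x * riemann G a i j k x * riemann G b p q r x

/-- The squared norm `|R|² = ¼ ∑ i j k l, R_{e_i, e_j}(e_k, e_l)²`. -/
def riemannNormSq (x : E3) : ℝ :=
  (1 / 4) * ∑ a, ∑ b, ∑ i, ∑ j, ∑ k, ∑ p, ∑ q, ∑ r,
    inv G a b x * inv G i p x * inv G j q x * inv G k r x
      * riemann G a i j k x * riemann G b p q r x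

/-- The covariant derivative `(∇_{∂_a} R)(∂_i, ∂_j, ∂_k, ∂_l)` of the Riemann tensor. -/
def nablaRiemann (a i j k l : Fin 3) (x : E3) : ℝ :=
  pd a (riemann G i j k l) x
    - ∑ m, (christoffel G m a i x * riemann G m j k l x
          + christoffel G m a j x * riemann G i m k l x
          + christoffel G m a k x * riemann G i j m l x
          + christoffel G m a l x * riemann G i j k m x)

/-- The formal adjoint `d_∇^*` of the exterior covariant derivative, applied to the curvature:
`(d_∇^* R)(v₁, v₂, v₃) = - ∑ i, (∇_{e_i} R)(e_i, v₁, v₂, v₃)`. -/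
def codiffRiemann (j k l : Fin 3) (x : E3) : ℝ :=
  - ∑ a, ∑ b, inv G a b x * nablaRiemann G a b j k l x

/-- `R(df)`, that is `(v₁, v₂, v₃) ↦ R(grad f, v₁, v₂, v₃)`. -/
def riemannGrad (j k l : Fin 3) (x : E3) : ℝ :=
  ∑ a, ∑ b, inv G a b x * pd a f x * riemann G b j k l x

/-- The Hessian `∇ df`. -/
def hessian (i j : Fin 3) (x : E3) : ℝ :=
  pd i (pd j f) x - ∑ k, christoffel G k i j x * pd k f x

/-- `δ df`, where `δ` is the formal adjoint of `d`, so that `δ df = - tr_g (∇ df)`. -/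
def codiffGrad (x : E3) : ℝ :=
  - ∑ a, ∑ b, inv G a b x * hessian G f a b x

/-- `|df|²`. -/
def gradNormSq (x : E3) : ℝ :=
  ∑ a, ∑ b, inv G a b x * pd a f x * pd b f x

end Coordinates

/-! ### Riemannian three-manifolds -/

section Manifold

variable {M : Type*} [TopologicalSpace M] [ChartedSpace E3 M]

/-- The smooth charts of `M`. -/
abbrev smoothCharts (M : Type*) [TopologicalSpace M] [ChartedSpace E3 M] :
    Set (OpenPartialHomeomorph M E3) :=
  IsManifold.maximalAtlas (𝓡 3) ∞ M

/-- The coordinate vector field `∂_i` of the chart `e`, at the point with coordinates `x`. -/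
def coordVec (e : OpenPartialHomeomorph M E3) (i : Fin 3) (x : E3) :
    TangentSpace (𝓡 3) (e.symm x) :=
  mfderiv (𝓡 3) (𝓡 3) e.symm x (basisVec i)

variable [IsManifold (𝓡 3) ∞ M]

/-- Smooth Riemannian metrics on `M`. -/
abbrev Metric (M : Type*) [TopologicalSpace M] [ChartedSpace E3 M] [IsManifold (𝓡 3) ∞ M] :=
  Bundle.ContMDiffRiemannianMetric (𝓡 3) ∞ E3 (fun p : M => TangentSpace (𝓡 3) p)

/-- The components `g_{ij} = g(∂_i, ∂_j)` of the metric `g` in the chart `e`. -/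
def coeff (g : Metric M) (e : OpenPartialHomeomorph M E3) (x : E3) :
    Matrix (Fin 3) (Fin 3) ℝ :=
  Matrix.of fun i j => g.inner (e.symm x) (coordVec e i x) (coordVec e j x)

/-- The metric `g` is flat: its Riemann tensor vanishes identically. -/
def IsFlat (g : Metric M) : Prop :=
  ∀ e ∈ smoothCharts M, ∀ x ∈ e.target, ∀ i j k l, riemann (coeff g e) i j k l x = 0

/-- The metric `g` is hyperbolic: its sectional curvature is a negative constant `K`, i.e.
`g(R(v, w) w, v) = K (g(v, v) g(w, w) - g(v, w)²)` for all tangent vectors `v = ∑ i, v i • ∂_i`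
and `w = ∑ i, w i • ∂_i`. -/
def IsHyperbolic (g : Metric M) : Prop :=
  ∃ K : ℝ, K < 0 ∧ ∀ e ∈ smoothCharts M, ∀ x ∈ e.target, ∀ v w : Fin 3 → ℝ,
    ∑ i, ∑ j, ∑ k, ∑ l, riemann (coeff g e) i j k l x * v i * w j * w k * v l
      = K * ((∑ i, ∑ j, coeff g e x i j * v i * v j) * (∑ i, ∑ j, coeff g e x i j * w i * w j)
          - (∑ i, ∑ j, coeff g e x i j * v i * w j) ^ 2)

/-- The metric `g` is Einstein: `Ric = c g` for a real constant `c`. -/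
def IsEinstein (g : Metric M) : Prop :=
  ∃ c : ℝ, ∀ e ∈ smoothCharts M, ∀ x ∈ e.target, ∀ i j,
    ricci (coeff g e) i j x = c * coeff g e x i j

/-- Near the point `p`, `(M, g)` is isometric to a Riemannian product of an interval and a surface:
around `p` there are coordinates `(x₀, x₁, x₂)` with `g = dx₀² + h`, where `h` is a metric in the
coordinates `(x₁, x₂)` which does not depend on `x₀`. -/
def IsLocalProductAt (g : Metric M) (p : M) : Prop :=
  ∃ e ∈ smoothCharts M, p ∈ e.source ∧ ∀ x ∈ e.target,
    coeff g e x 0 0 = 1 ∧ coeff g e x 0 1 = 0 ∧ coeff g e x 0 2 = 0 ∧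
      ∀ i j, pd 0 (fun y => coeff g e y i j) x = 0

/-- `(g, φ)` is a Heterotic soliton with vanishing torsion, with parameter `κ`: the function `φ` is
smooth and `(g, φ)` solves the Einstein, the Yang-Mills and the dilaton equation. The three
equations are equalities of tensors, written out in all smooth charts. -/
structure IsTorsionlessSoliton (κ : ℝ) (g : Metric M) (φ : M → ℝ) : Prop where
  smooth : ContMDiff (𝓡 3) 𝓘(ℝ, ℝ) ∞ φ
  einstein : ∀ e ∈ smoothCharts M, ∀ x ∈ e.target, ∀ i j,
    ricci (coeff g e) i j x + hessian (coeff g e) (φ ∘ e.symm) i j x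
      - (1 / 2) * Real.exp (2 * φ (e.symm x)) * coeff g e x i j
      + κ * riemannSquare (coeff g e) i j x = 0
  yangMills : ∀ e ∈ smoothCharts M, ∀ x ∈ e.target, ∀ j k l,
    codiffRiemann (coeff g e) j k l x + riemannGrad (coeff g e) (φ ∘ e.symm) j k l x = 0
  dilaton : ∀ e ∈ smoothCharts M, ∀ x ∈ e.target,
    codiffGrad (coeff g e) (φ ∘ e.symm) x + gradNormSq (coeff g e) (φ ∘ e.symm) x
      - Real.exp (2 * φ (e.symm x)) + κ * riemannNormSq (coeff g e) x = 0

/-- The dilaton `φ` is constant. -/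
def IsConstant (φ : M → ℝ) : Prop := ∃ c : ℝ, ∀ p, φ p = c

end Manifold

end Heterotic

end

/-! In dimension three the Hodge star turns two-forms into vectors, so the whole curvature is
carried by one `g`-self-adjoint endomorphism `A` (`curvField`). In terms of it `Ric = (tr A) g -
gA`, `R ∘ R = (tr A²) g - gA²` and `|R|² = tr A²`; constant curvature `K` means `A = K`.

Let `φ` be constant and `c = e^{2φ} > 0`. The dilaton equation is `κ tr A² = c`; with it, the
Einstein equation and its trace give `tr A = -c/4` and `A + κA² = c/4`. As `tr A` is constant, the
Yang-Mills equation `div R = 0` makes `∇A` a Codazzi tensor, hence totally symmetric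
(`codazzi_of_divergence`). Differentiating the quadratic equation shows that `∇A` anticommutes with
`P = A + 1/(2κ)`, whose square is a nonzero scalar (`shift_sq_of_soliton`). Total symmetry and
anticommutation together force `∇A = 0` (`eq_zero_of_anticommute`). A parallel `A` commutes with the
curvature it encodes, and a trace of that is a second quadratic equation
(`quadratic_of_commute_curvature`). The two combine to `(κc/4 - 1)(3A + c/4) = 0`, from which `A =
-c/12` and `κc = 48` (`eq_smul_one_of_soliton`). So the curvature is the constant `-c/12`, which
gives all the stated values; no local product can occur, since a product has a parallel field killed
by the curvature.

Conversely, constant curvature `K ≠ 0` is parallel, so the Yang-Mills equation reduces to `R(grad φ)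
= 0` and hence `dφ = 0`; the dilaton equation then fixes the value of `e^{2φ}`. -/

namespace Heterotic

open Matrix Bundle

/-! ### Levi-Civita identities for three by three matrices -/

/-- The Levi-Civita symbol. -/
def levi (i j k : Fin 3) : ℝ :=
  (![![![0, 0, 0], ![0, 0, 1], ![0, -1, 0]], ![![0, 0, -1], ![0, 0, 0], ![1, 0, 0]],
    ![![0, 1, 0], ![-1, 0, 0], ![0, 0, 0]]] : Fin 3 → Fin 3 → Fin 3 → ℝ) i j k

theorem contract_skew (H : Matrix (Fin 3) (Fin 3) ℝ) (hH : Hᵀ = H) (w w' : Fin 3 → ℝ) :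
    ∑ j, ∑ k, ∑ q, ∑ r, H j q * H k r * (∑ d, levi j k d * w d) * (∑ d, levi q r d * w' d)
      = 2 * ∑ c, ∑ d, w c * w' d * H.adjugate c d := by
  have h : ∀ i j, H i j = H j i := fun i j => congrFun (congrFun hH j) i
  rw [Matrix.adjugate_fin_three]
  simp [levi, Fin.sum_univ_three, h 1 0, h 2 0, h 2 1]
  ring

/-- The curvature-like tensor with components `- ε_{ijc} ε_{kld} N^{cd}`. -/
def ofDual (N : Matrix (Fin 3) (Fin 3) ℝ) (i j k l : Fin 3) : ℝ :=
  -∑ d, levi k l d * ∑ c, levi i j c * N c d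

/-- The index `c` stands for the pair `(c + 1, c + 2)` modulo 3; a tensor skew in each pair is
determined by its values on such pairs. -/
theorem eq_ofDual {R : Fin 3 → Fin 3 → Fin 3 → Fin 3 → ℝ}
    (h1 : ∀ i j k l, R i j k l = -R j i k l) (h2 : ∀ i j k l, R i j k l = -R i j l k)
    (i j k l : Fin 3) :
    R i j k l = ofDual (Matrix.of fun c d => -R (c + 1) (c + 2) (d + 1) (d + 2)) i j k l := by
  have h10 : ∀ i k l, R i i k l = 0 := fun i k l => by linarith [h1 i i k l]
  have h20 : ∀ i j k, R i j k k = 0 := fun i j k => by linarith [h2 i j k k]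
  fin_cases i <;> fin_cases j <;> fin_cases k <;> fin_cases l <;>
    simp [ofDual, levi, Fin.sum_univ_three, h10, h20] <;>
    first
    | exact h1 _ _ _ _
    | exact h2 _ _ _ _
    | exact (h1 _ _ _ _).trans (congrArg Neg.neg (h2 _ _ _ _)) |>.trans (neg_neg _)

/-- The contraction `H^{ip} ε_{aic} ε_{bpd} X^{cd}`. -/
def leviContract (H X : Matrix (Fin 3) (Fin 3) ℝ) (a b : Fin 3) : ℝ :=
  ∑ i, ∑ p, H i p * ∑ d, levi b p d * ∑ c, levi a i c * X c d

/-- The factor `H.det` makes both sides polynomial, so the identity can be checked entry by entry.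
-/
theorem det_mul_leviContract (H X : Matrix (Fin 3) (Fin 3) ℝ) (hH : Hᵀ = H) (hX : Xᵀ = X)
    (a b : Fin 3) :
    H.det * leviContract H X a b
      = (X * H.adjugate).trace * H.adjugate a b - (H.adjugate * X * H.adjugate) a b := by
  have h : ∀ i j, H i j = H j i := fun i j => congrFun (congrFun hH j) i
  have hx : ∀ i j, X i j = X j i := fun i j => congrFun (congrFun hX j) i
  simp only [Matrix.trace, Matrix.diag_apply, Matrix.mul_apply, Fin.sum_univ_three, leviContract]
  rw [Matrix.adjugate_fin_three, Matrix.det_fin_three]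
  fin_cases a <;> fin_cases b <;>
    simp [levi, h 1 0, h 2 0, h 2 1, hx 1 0, hx 2 0, hx 2 1] <;> ring

theorem det_mul_ofDual (G N : Matrix (Fin 3) (Fin 3) ℝ) (hG : Gᵀ = G) (hN : Nᵀ = N)
    (i j k l : Fin 3) :
    G.det * ofDual N i j k l =
      (N * G).trace * (G i l * G j k - G i k * G j l)
      - ((G * N * G) i l * G j k + (G * N * G) j k * G i l
        - (G * N * G) i k * G j l - (G * N * G) j l * G i k) := by
  have h : ∀ i j, G i j = G j i := fun i j => congrFun (congrFun hG j) i
  have hx : ∀ i j, N i j = N j i := fun i j => congrFun (congrFun hN j) i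
  rw [Matrix.det_fin_three]
  fin_cases i <;> fin_cases j <;> fin_cases k <;> fin_cases l <;>
    simp [ofDual, levi, Fin.sum_univ_three, Matrix.trace, Matrix.mul_apply, h 1 0, h 2 0, h 2 1,
      hx 1 0, hx 2 0, hx 2 1, -mul_eq_zero, -zero_eq_mul] <;> ring

theorem cayley_hamilton_fin_three (A : Matrix (Fin 3) (Fin 3) ℝ) :
    A * A * A - A.trace • (A * A) + ((A.trace ^ 2 - (A * A).trace) / 2) • A - A.det • 1 = 0 := by
  ext i j
  rw [Matrix.det_fin_three]
  fin_cases i <;> fin_cases j <;> simp [Matrix.trace, Matrix.mul_apply, Fin.sum_univ_three] <;> ring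

/-! ### Smoothness and nondegeneracy of the metric coefficients -/

section CoordinateMetric

variable {M : Type*} [TopologicalSpace M] [ChartedSpace E3 M]

theorem sum_coordVec (e : OpenPartialHomeomorph M E3) (x : E3) (v : Fin 3 → ℝ) :
    mfderiv (𝓡 3) (𝓡 3) e.symm x (WithLp.toLp 2 v : E3) = ∑ i, v i • coordVec e i x := by
  have : (WithLp.toLp 2 v : E3) = ∑ i, v i • basisVec i := by
    ext k
    simp [basisVec, Finset.sum_apply, Pi.single_apply]
  rw [this]
  simp only [coordVec]
  erw [map_sum]
  refine Finset.sum_congr rfl fun i _ => ?_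
  erw [map_smul]

variable [IsManifold (𝓡 3) ∞ M]

theorem coeff_symm (g : Metric M) (e : OpenPartialHomeomorph M E3) (x : E3) :
    (coeff g e x)ᵀ = coeff g e x := by
  ext i j
  exact g.symm _ _ _

/-- The coordinate field is the tangent map of `e.symm` composed with a constant section, and both
are smooth. -/
theorem contMDiffOn_coordVec {e : OpenPartialHomeomorph M E3} (he : e ∈ smoothCharts M)
    (i : Fin 3) :
    ContMDiffOn (𝓡 3) (𝓡 3).tangent ∞
      (fun x => (⟨e.symm x, coordVec e i x⟩ : TangentBundle (𝓡 3) M)) e.target := by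
  have : IsManifold (𝓡 3) 1 M := IsManifold.of_le (n := ∞) (by simp)
  have h := contMDiffOn_symm_of_mem_maximalAtlas (I := 𝓡 3) (n := ∞) he
  have h1 := h.contMDiffOn_tangentMapWithin (m := ∞) (by simp) e.open_target.uniqueMDiffOn
  have hs : ContMDiffOn (𝓡 3) (𝓡 3).tangent ∞
      (fun x => (⟨x, basisVec i⟩ : TangentBundle (𝓡 3) E3)) e.target := by
    intro x hx
    exact (contMDiffWithinAt_vectorSpace_iff_contDiffWithinAt
      (V := fun _ => basisVec i)).2 contDiffWithinAt_const
  refine (h1.comp hs (fun x hx => hx)).congr fun x hx => ?_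
  simp only [Function.comp, tangentMapWithin, coordVec]
  rw [mfderivWithin_of_isOpen e.open_target hx]

theorem contDiffOn_coeff (g : Metric M) {e : OpenPartialHomeomorph M E3} (he : e ∈ smoothCharts M)
    (i j : Fin 3) : ContDiffOn ℝ ∞ (fun x => coeff g e x i j) e.target := by
  have : IsManifold (𝓡 3) 1 M := IsManifold.of_le (n := ∞) (by simp)
  have hg : ContMDiffOn (𝓡 3) ((𝓡 3).prod 𝓘(ℝ, E3 →L[ℝ] E3 →L[ℝ] ℝ)) ∞
      (fun x => TotalSpace.mk' (E3 →L[ℝ] E3 →L[ℝ] ℝ)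
        (E := fun p : M => TangentSpace (𝓡 3) p →L[ℝ] TangentSpace (𝓡 3) p →L[ℝ] ℝ)
        (e.symm x) (g.inner (e.symm x))) e.target :=
    g.contMDiff.comp_contMDiffOn (contMDiffOn_symm_of_mem_maximalAtlas (I := 𝓡 3) (n := ∞) he)
  have h : ContMDiffOn (𝓡 3) ((𝓡 3).prod 𝓘(ℝ, ℝ)) ∞ (fun x => TotalSpace.mk' ℝ
      (E := Bundle.Trivial M ℝ) (e.symm x) (coeff g e x i j)) e.target :=
    ContMDiffOn.clm_bundle_apply₂ (F₁ := E3) (F₂ := E3) hg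
      (contMDiffOn_coordVec he i) (contMDiffOn_coordVec he j)
  rw [← contMDiffOn_iff_contDiffOn]
  intro x hx
  have := (contMDiffWithinAt_totalSpace.1 (h x hx)).2
  simpa using this

/-- A null vector of the coefficient matrix would be sent by the injective differential of `e.symm`
to a nonzero tangent vector of length zero. -/
theorem det_coeff_ne_zero (g : Metric M) {e : OpenPartialHomeomorph M E3}
    (he : e ∈ smoothCharts M) {x : E3} (hx : x ∈ e.target) : (coeff g e x).det ≠ 0 := by
  intro hdet
  obtain ⟨v, hv, hGv⟩ := Matrix.exists_mulVec_eq_zero_iff.2 hdet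
  have hmd : e.MDifferentiable (𝓡 3) (𝓡 3) :=
    ⟨(contMDiffOn_of_mem_maximalAtlas (I := 𝓡 3) (n := ∞) he).mdifferentiableOn (by simp),
     (contMDiffOn_symm_of_mem_maximalAtlas (I := 𝓡 3) (n := ∞) he).mdifferentiableOn (by simp)⟩
  have hinj := hmd.symm.mfderiv_injective hx
  have hw : mfderiv (𝓡 3) (𝓡 3) e.symm x (WithLp.toLp 2 v : E3) ≠ 0 := by
    intro h0
    have := hinj (h0.trans (map_zero _).symm)
    exact hv (congrArg WithLp.ofLp this)
  have hp := g.pos _ _ hw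
  rw [sum_coordVec] at hp
  have : g.inner (e.symm x) (∑ i, v i • coordVec e i x) (∑ i, v i • coordVec e i x)
      = v ⬝ᵥ (coeff g e x *ᵥ v) := by
    simp [dotProduct, Matrix.mulVec, coeff, Fin.sum_univ_three]
    ring
  rw [this, hGv] at hp
  simp at hp

end CoordinateMetric

/-! ### The curvature endomorphism at a point and its contractions -/

theorem sum_rotate (f : Fin 3 → Fin 3 → Fin 3 → ℝ) :
    ∑ j, ∑ k, ∑ p, f j k p = ∑ p, ∑ j, ∑ k, f j k p :=
  (Finset.sum_congr rfl fun _ _ => Finset.sum_comm).trans Finset.sum_comm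

/-- The Kulkarni-Nomizu type product `S_{il} G_{jk} + S_{jk} G_{il} - S_{ik} G_{jl} - S_{jl} G_{ik}`
of two symmetric bilinear forms. -/
def kulkarni (S G : Matrix (Fin 3) (Fin 3) ℝ) (i j k l : Fin 3) : ℝ :=
  S i l * G j k + S j k * G i l - S i k * G j l - S j l * G i k

section Pointwise

variable {G H N : Matrix (Fin 3) (Fin 3) ℝ} {R : Fin 3 → Fin 3 → Fin 3 → Fin 3 → ℝ}

/-- The curvature operator on two-forms, viewed through the Hodge star as an endomorphism. -/
noncomputable def curvEndo (G N : Matrix (Fin 3) (Fin 3) ℝ) : Matrix (Fin 3) (Fin 3) ℝ := G.det⁻¹ • (N * G)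

theorem mul_curvEndo_symm (hG : Gᵀ = G) (hN : Nᵀ = N) :
    (G * curvEndo G N)ᵀ = G * curvEndo G N := by
  simp [curvEndo, Matrix.transpose_mul, hG, hN, Matrix.mul_assoc]

/-- There is no Weyl tensor in dimension three: the first argument of `kulkarni` is the Schouten
tensor `Ric - (s/4) g` written through `A`. -/
theorem ofDual_eq_kulkarni (hG : Gᵀ = G) (hd : G.det ≠ 0) (hN : Nᵀ = N) (i j k l : Fin 3) :
    ofDual N i j k l =
      kulkarni (((curvEndo G N).trace / 2) • G - G * curvEndo G N) G i j k l := by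
  have h := det_mul_ofDual G N hG hN i j k l
  have hGA : G * curvEndo G N = G.det⁻¹ • (G * N * G) := by
    simp [curvEndo, Matrix.mul_assoc]
  have ht : (curvEndo G N).trace = G.det⁻¹ * (N * G).trace := by simp [curvEndo]
  rw [hGA, ht]
  simp only [kulkarni, Matrix.sub_apply, Matrix.smul_apply, smul_eq_mul]
  apply mul_left_cancel₀ hd
  rw [h]
  field_simp
  ring

theorem adjugate_inv_eq (hH : H = G⁻¹) (hd : G.det ≠ 0) : H.adjugate = G.det⁻¹ • G := by
  have hu : IsUnit G.det := isUnit_iff_ne_zero.2 hd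
  have h1 : G * H = 1 := hH ▸ Matrix.mul_nonsing_inv G hu
  have h2 : H.det = G.det⁻¹ := by
    rw [hH, Matrix.det_nonsing_inv, Ring.inverse_eq_inv']
  calc H.adjugate = G * H * H.adjugate := by rw [h1, one_mul]
    _ = G.det⁻¹ • G := by rw [mul_assoc, Matrix.mul_adjugate, h2]; simp

theorem leviContract_inv (hG : Gᵀ = G) (hH : H = G⁻¹) (hd : G.det ≠ 0)
    {X : Matrix (Fin 3) (Fin 3) ℝ} (hX : Xᵀ = X) (a b : Fin 3) :
    leviContract H X a b = (curvEndo G X).trace * G a b - (G * curvEndo G X) a b := by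
  have h2 : H.det = G.det⁻¹ := by
    rw [hH, Matrix.det_nonsing_inv, Ring.inverse_eq_inv']
  have hHs : Hᵀ = H := by rw [hH, Matrix.transpose_nonsing_inv, hG]
  have h := det_mul_leviContract H X hHs hX a b
  rw [adjugate_inv_eq hH hd, h2] at h
  have hGA : G * curvEndo G X = G.det⁻¹ • (G * X * G) := by
    simp [curvEndo, Matrix.mul_assoc]
  have ht : (curvEndo G X).trace = G.det⁻¹ * (X * G).trace := by simp [curvEndo]
  rw [hGA, ht]
  simp only [Matrix.mul_smul, Matrix.smul_mul, Matrix.trace_smul, Matrix.smul_apply,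
    smul_eq_mul] at h ⊢
  apply mul_left_cancel₀ (inv_ne_zero hd)
  rw [h]
  ring

theorem contract_ofDual (N : Matrix (Fin 3) (Fin 3) ℝ) (j k : Fin 3) :
    ∑ a, ∑ b, H a b * ofDual N a j k b = leviContract H N j k := by
  have hl : ∀ a j c, levi a j c = -levi j a c := by
    intro a j c
    fin_cases a <;> fin_cases j <;> fin_cases c <;> simp [levi]
  refine Finset.sum_congr rfl fun a _ => Finset.sum_congr rfl fun b _ => ?_
  simp only [ofDual, hl a j]
  simp only [Fin.sum_univ_three]
  ring

/-- Contracting the last two index pairs with `contract_skew` yields twice an adjugate, which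
absorbs the factor `1 / 2`; the one remaining contraction is `leviContract`. -/
theorem contract_ofDual_sq (hHs : Hᵀ = H) (N : Matrix (Fin 3) (Fin 3) ℝ) (a b : Fin 3) :
    (1 / 2) * ∑ i, ∑ j, ∑ k, ∑ p, ∑ q, ∑ r,
      H i p * H j q * H k r * ofDual N a i j k * ofDual N b p q r
      = leviContract H (N * H.adjugate * Nᵀ) a b := by
  have hw : ∀ (K : Matrix (Fin 3) (Fin 3) ℝ) (u v : Fin 3 → ℝ),
      ∑ c, ∑ d, (-∑ c', u c' * N c' c) * (-∑ d', v d' * N d' d) * K c d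
        = ∑ d, v d * ∑ c, u c * (N * K * Nᵀ) c d := by
    intro K u v
    simp only [Fin.sum_univ_three, Matrix.mul_apply, Matrix.transpose_apply]
    ring
  have hR : ∀ a i j k, ofDual N a i j k = ∑ d, levi j k d * (-∑ c, levi a i c * N c d) := by
    intro a i j k
    simp only [ofDual, Fin.sum_univ_three]
    ring
  rw [Finset.mul_sum]
  refine Finset.sum_congr rfl fun i _ => ?_
  rw [sum_rotate, Finset.mul_sum]
  refine Finset.sum_congr rfl fun p _ => ?_
  rw [← hw]
  have := contract_skew H hHs (fun d => -∑ c, levi a i c * N c d) (fun d => -∑ c, levi b p c * N c d)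
  have h2 : ∑ c, ∑ d, (-∑ c', levi a i c' * N c' c) * (-∑ d', levi b p d' * N d' d) * H.adjugate c d
      = (1 / 2) * ∑ j, ∑ k, ∑ q, ∑ r, H j q * H k r * ofDual N a i j k * ofDual N b p q r := by
    simp only [hR]
    rw [this]
    ring
  rw [h2]
  simp only [Finset.mul_sum]
  refine Finset.sum_congr rfl fun j _ => Finset.sum_congr rfl fun k _ =>
    Finset.sum_congr rfl fun q _ => Finset.sum_congr rfl fun r _ => ?_
  ring

theorem contract_ofDual_sq_eq (hG : Gᵀ = G) (hH : H = G⁻¹) (hd : G.det ≠ 0) (hN : Nᵀ = N)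
    (a b : Fin 3) :
    (1 / 2) * ∑ i, ∑ j, ∑ k, ∑ p, ∑ q, ∑ r,
      H i p * H j q * H k r * ofDual N a i j k * ofDual N b p q r
      = (curvEndo G N * curvEndo G N).trace * G a b
        - (G * (curvEndo G N * curvEndo G N)) a b := by
  have hHs : Hᵀ = H := by rw [hH, Matrix.transpose_nonsing_inv, hG]
  have hX : (N * H.adjugate * Nᵀ)ᵀ = N * H.adjugate * Nᵀ := by
    rw [Matrix.transpose_mul, Matrix.transpose_mul, Matrix.adjugate_transpose, hHs,
      Matrix.transpose_transpose, Matrix.mul_assoc]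
  rw [contract_ofDual_sq hHs, leviContract_inv hG hH hd hX]
  have : curvEndo G (N * H.adjugate * Nᵀ) = curvEndo G N * curvEndo G N := by
    rw [adjugate_inv_eq hH hd, hN]
    simp [curvEndo, Matrix.mul_assoc]
  rw [this]

theorem contract_metric (hH : H = G⁻¹) (hd : G.det ≠ 0) (A : Matrix (Fin 3) (Fin 3) ℝ)
    (hG : Gᵀ = G) (hA : (G * A)ᵀ = G * A) (t : ℝ) :
    ∑ a, ∑ b, H a b * (t * G a b - (G * A) a b) = 3 * t - A.trace := by
  have hu : IsUnit G.det := isUnit_iff_ne_zero.2 hd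
  have h1 : H * G = 1 := hH ▸ Matrix.nonsing_inv_mul G hu
  have h2 : H * (G * A) = A := by rw [← Matrix.mul_assoc, h1, Matrix.one_mul]
  have htr : ∀ B : Matrix (Fin 3) (Fin 3) ℝ, ∑ a, ∑ b, H a b * B a b = (H * Bᵀ).trace := by
    intro B
    simp only [Matrix.trace, Matrix.diag_apply, Matrix.mul_apply, Matrix.transpose_apply]
  have e1 := htr (t • G - G * A)
  simp only [Matrix.sub_apply, Matrix.smul_apply, smul_eq_mul] at e1
  rw [e1, Matrix.transpose_sub, Matrix.transpose_smul, hG, hA, Matrix.mul_sub, h2, Matrix.mul_smul,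
    h1]
  simp
  ring

end Pointwise

/-! ### Algebraic symmetries of curvature tensors -/

section CurvatureSymmetries

variable {R : Fin 3 → Fin 3 → Fin 3 → Fin 3 → ℝ}

/-- The octahedron argument: combine the Bianchi identities at the four cyclic shifts of `(i, j, k,
l)`. -/
theorem pair_symm_of_bianchi (h1 : ∀ i j k l, R i j k l = -R j i k l)
    (h2 : ∀ i j k l, R i j k l = -R i j l k)
    (h3 : ∀ i j k l, R i j k l + R j k i l + R k i j l = 0) (i j k l : Fin 3) :
    R i j k l = R k l i j := by
  linarith [h3 i j k l, h3 j k l i, h3 k l i j, h3 l i j k, h2 i j k l, h2 j k i l, h1 k i j l,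
    h2 i k j l, h2 k l i j, h1 l j k i, h2 j l k i, h2 l i j k]

/-- Polarisation in `w` kills the components with a repeated index. In dimension three two index
pairs always share an index, so nothing else is left. -/
theorem eq_zero_of_sectional_eq_zero (h1 : ∀ i j k l, R i j k l = -R j i k l)
    (h2 : ∀ i j k l, R i j k l = -R i j l k) (h3 : ∀ i j k l, R i j k l = R k l i j)
    (h : ∀ v w : Fin 3 → ℝ, ∑ i, ∑ j, ∑ k, ∑ l, R i j k l * v i * w j * w k * v l = 0)
    (i j k l : Fin 3) : R i j k l = 0 := by
  have hq : ∀ (i : Fin 3) (w : Fin 3 → ℝ), ∑ j, ∑ k, R i j k i * w j * w k = 0 := by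
    intro i w
    simpa [Pi.single_apply] using h (Pi.single i 1) w
  have hs : ∀ i j k, R i j k i = 0 := by
    intro i j k
    have a := hq i (Pi.single j 1 + Pi.single k 1)
    have b := hq i (Pi.single j 1)
    have c := hq i (Pi.single k 1)
    simp [Pi.single_apply, mul_add, Finset.sum_add_distrib] at a b c
    linarith [h3 i k j i, h1 j i i k, h2 i j i k]
  have hik : ∀ i j l, R i j i l = 0 := fun i j l => by rw [h2, hs, neg_zero]
  have hjk : ∀ i j l, R i j j l = 0 := fun i j l => by rw [h1, hik, neg_zero]
  have : (Matrix.of fun c d => -R (c + 1) (c + 2) (d + 1) (d + 2)) = 0 := by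
    ext c d
    fin_cases c <;> fin_cases d <;> simp [hs, hik, hjk]
  rw [eq_ofDual h1 h2, this]
  simp [ofDual]

end CurvatureSymmetries

/-! ### Linear algebra of the soliton equations -/

section Endomorphisms

variable {G H A : Matrix (Fin 3) (Fin 3) ℝ}

/-- With `T = ∇B`, the hypothesis says that the curvature-type tensor built from `B` is divergence
free. It reads `d_l G_jk + T_ljk = d_k G_jl + T_kjl`, where `d` is the divergence of `B`, so it
suffices that `d = 0`. -/
theorem codazzi_of_divergence {T : Fin 3 → Matrix (Fin 3) (Fin 3) ℝ}
    (hHG : H * G = 1) (hHs : Hᵀ = H) (hG : Gᵀ = G) (hT : ∀ a, (T a)ᵀ = T a)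
    (htr : ∀ a, (H * T a).trace = 0)
    (h : ∀ j k l, ∑ a, ∑ b, H a b * kulkarni (T a) G b j k l = 0) (l j k : Fin 3) :
    T l j k = T k j l := by
  have hTs : ∀ a i j, T a i j = T a j i := fun a i j => congrFun (congrFun (hT a) j) i
  have hGs : ∀ i j, G i j = G j i := fun i j => congrFun (congrFun hG j) i
  have hH : ∀ i j, H i j = H j i := fun i j => congrFun (congrFun hHs j) i
  have hδ : ∀ a l, ∑ b, H a b * G b l = if a = l then 1 else 0 := by
    intro a l
    rw [← Matrix.mul_apply, hHG, Matrix.one_apply]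
  set d : Fin 3 → ℝ := fun l => ∑ a, ∑ b, H a b * T a b l with hd
  have key : ∀ j k l, d l * G j k + T l j k - d k * G j l - T k j l = 0 := by
    intro j k l
    have e : ∑ a, ∑ b, H a b * kulkarni (T a) G b j k l
        = d l * G j k + ∑ a, T a j k * ∑ b, H a b * G b l - d k * G j l
          - ∑ a, T a j l * ∑ b, H a b * G b k := by
      simp only [hd, kulkarni, Fin.sum_univ_three]
      ring
    rw [h] at e
    simp only [hδ, mul_ite, mul_one, mul_zero, Finset.sum_ite_eq', Finset.mem_univ, if_true] at e
    exact e.symm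
  -- Tracing over `j, k` gives `3d + tr T - d - d = d`, because `T` is trace free.
  have hd0 : ∀ l, d l = 0 := by
    intro l
    have e : ∑ j, ∑ k, H j k * (d l * G j k + T l j k - d k * G j l - T k j l)
        = d l * (∑ j, ∑ k, H j k * G k j) + (H * T l).trace - ∑ k, d k * ∑ j, H k j * G j l
          - d l := by
      simp only [Matrix.trace, Matrix.diag_apply, Matrix.mul_apply, hd, Fin.sum_univ_three,
        hH 1 0, hH 2 0, hH 2 1, hGs 1 0, hGs 2 0, hGs 2 1, hTs l 1 0, hTs l 2 0, hTs l 2 1,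
        hTs _ _ l]
      ring
    simp only [key, hδ, htr, mul_zero, Finset.sum_const_zero, mul_ite, mul_one,
      Finset.sum_ite_eq', Finset.mem_univ, if_true] at e
    simp at e
    linarith
  have := key j k l
  rw [hd0, hd0] at this
  linarith

/-- `T_l P` is skew in its matrix indices, while total symmetry of `T` makes it symmetric in `l` and
the first matrix index. Such a three-index array vanishes, and `P` is invertible. -/
theorem eq_zero_of_anticommute {T : Fin 3 → Matrix (Fin 3) (Fin 3) ℝ}
    {P : Matrix (Fin 3) (Fin 3) ℝ} {μ : ℝ} (hμ : μ ≠ 0) (hP : P * P = μ • 1)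
    (hT : ∀ a, (T a)ᵀ = T a) (hcod : ∀ l j k, T l j k = T k j l)
    (h : ∀ a, T a * P + Pᵀ * T a = 0) (a : Fin 3) : T a = 0 := by
  have hTs : ∀ a i j, T a i j = T a j i := fun a i j => congrFun (congrFun (hT a) j) i
  have hanti : ∀ l i j, (T l * P) i j = -(T l * P) j i := by
    intro l i j
    have e := congrFun (congrFun (h l) i) j
    have : (Pᵀ * T l) i j = (T l * P) j i := by
      rw [← Matrix.transpose_apply (T l * P), Matrix.transpose_mul, hT]
    rw [Matrix.add_apply, this, Matrix.zero_apply] at e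
    linarith
  have hsymm : ∀ l i j, (T l * P) i j = (T i * P) l j := by
    intro l i j
    simp only [Matrix.mul_apply]
    refine Finset.sum_congr rfl fun m _ => ?_
    rw [hTs l i m, hcod l m i, hTs i m l]
  have hz : T a * P = 0 := by
    ext i j
    rw [Matrix.zero_apply]
    -- Alternating the two symmetries three times returns the same entry with the opposite sign.
    linarith [hanti a i j, hsymm a j i, hanti j a i, hsymm j i a, hanti i j a, hsymm i a j]
  have : μ • T a = 0 := by
    calc μ • T a = T a * (P * P) := by rw [hP]; simp
      _ = 0 := by rw [← Matrix.mul_assoc, hz, Matrix.zero_mul]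
  exact (smul_eq_zero.1 this).resolve_left hμ

/-- Insert the Schouten form of the curvature into `[R(∂_a, ∂_b), A] = 0` and contract the upper
index with `a`. -/
theorem quadratic_of_commute_curvature {Rm : Fin 3 → Fin 3 → Matrix (Fin 3) (Fin 3) ℝ}
    (hHG : H * G = 1) (hG : Gᵀ = G) (hA : (G * A)ᵀ = G * A)
    (hR : ∀ a b k l, (G * Rm a b) l k = kulkarni ((A.trace / 2) • G - G * A) G a b k l)
    (hc : ∀ a b, Rm a b * A = A * Rm a b) :
    (3 : ℝ) • (A * A) - (3 * A.trace) • A + (A.trace ^ 2 - (A * A).trace) • 1 = 0 := by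
  set C : Matrix (Fin 3) (Fin 3) ℝ := (A.trace / 2) • 1 - A with hC
  set S : Matrix (Fin 3) (Fin 3) ℝ := (A.trace / 2) • G - G * A with hS
  have hSC : S = G * C := by rw [hS, hC, Matrix.mul_sub, Matrix.mul_smul, Matrix.mul_one]
  have hSs : Sᵀ = S := by rw [hS, Matrix.transpose_sub, Matrix.transpose_smul, hG, hA]
  have hHS : H * S = C := by rw [hSC, ← Matrix.mul_assoc, hHG, Matrix.one_mul]
  have hRm : ∀ a b l k, Rm a b l k = C l a * G b k + (1 : Matrix (Fin 3) (Fin 3) ℝ) l a * S b k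
      - (1 : Matrix (Fin 3) (Fin 3) ℝ) l b * S a k - C l b * G a k := by
    intro a b l k
    have e : Rm a b = H * (G * Rm a b) := by rw [← Matrix.mul_assoc, hHG, Matrix.one_mul]
    have eK : G * Rm a b = Matrix.of fun l k => kulkarni S G a b k l := by
      ext l k
      exact hR a b k l
    rw [e, eK, ← hHS, ← hHG]
    simp only [Matrix.mul_apply, Matrix.of_apply, kulkarni]
    have g1 : ∀ i j, G i j = G j i := fun i j => congrFun (congrFun hG j) i
    have s1 : ∀ i j, S i j = S j i := fun i j => congrFun (congrFun hSs j) i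
    simp only [Fin.sum_univ_three, s1 a 0, s1 a 1, s1 a 2, s1 b 0, s1 b 1, s1 b 2, g1 a 0, g1 a 1,
      g1 a 2, g1 b 0, g1 b 1, g1 b 2]
    ring
  have hGA : Aᵀ * G = G * A := by rw [← hA, Matrix.transpose_mul, hG]
  have hAC : A * C = C * A := by
    rw [hC, Matrix.mul_sub, Matrix.sub_mul]
    simp
  have main : G * ((C.trace) • A + C * A)
      = G * ((A * C).trace • 1 + A.trace • C - (2 : ℝ) • (A * C)) := by
    ext b k
    have l1 : ∑ a, (Rm a b * A) a k = C.trace * (G * A) b k + (S * A) b k := by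
      simp only [Matrix.mul_apply, hRm, Matrix.trace, Matrix.diag_apply]
      have s2 : ∀ m, S b m = ∑ a, C a b * G a m := by
        intro m
        rw [← hSs, Matrix.transpose_apply, hSC, Matrix.mul_apply]
        exact Finset.sum_congr rfl fun a _ => by
          rw [mul_comm, ← Matrix.transpose_apply G, hG]
      have s3 : ∀ m, ∑ a, (1 : Matrix (Fin 3) (Fin 3) ℝ) a b * S a m = S b m := by
        intro m
        simp [Matrix.one_apply]
      have e : ∑ a, ∑ m, (C a a * G b m + (1 : Matrix (Fin 3) (Fin 3) ℝ) a a * S b m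
          - (1 : Matrix (Fin 3) (Fin 3) ℝ) a b * S a m - C a b * G a m) * A m k
          = (∑ a, C a a) * ∑ m, G b m * A m k + 3 * ∑ m, S b m * A m k
            - ∑ m, (∑ a, (1 : Matrix (Fin 3) (Fin 3) ℝ) a b * S a m) * A m k
            - ∑ m, (∑ a, C a b * G a m) * A m k := by
        simp only [Fin.sum_univ_three, Matrix.one_apply_eq]
        ring
      rw [e]
      simp only [s3, ← s2]
      ring
    have l2 : ∑ a, (A * Rm a b) a k = (A * C).trace * G b k + A.trace * S b k
        - (Aᵀ * S) b k - ((A * C)ᵀ * G) b k := by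
      simp only [Matrix.mul_apply, hRm, Matrix.trace, Matrix.diag_apply, Matrix.transpose_apply]
      have s3 : ∀ a, ∑ m, A a m * (1 : Matrix (Fin 3) (Fin 3) ℝ) m a = A a a := by
        intro a
        rw [← Matrix.mul_apply, Matrix.mul_one]
      have s4 : ∀ a, ∑ m, A a m * (1 : Matrix (Fin 3) (Fin 3) ℝ) m b = A a b := by
        intro a
        rw [← Matrix.mul_apply, Matrix.mul_one]
      have e : ∑ a, ∑ m, A a m * (C m a * G b k + (1 : Matrix (Fin 3) (Fin 3) ℝ) m a * S b k
          - (1 : Matrix (Fin 3) (Fin 3) ℝ) m b * S a k - C m b * G a k)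
          = (∑ a, ∑ m, A a m * C m a) * G b k
            + (∑ a, ∑ m, A a m * (1 : Matrix (Fin 3) (Fin 3) ℝ) m a) * S b k
            - ∑ a, (∑ m, A a m * (1 : Matrix (Fin 3) (Fin 3) ℝ) m b) * S a k
            - ∑ a, (∑ m, A a m * C m b) * G a k := by
        simp only [Fin.sum_univ_three]
        ring
      rw [e]
      simp only [s3, s4]
    have l3 : Aᵀ * S = G * (A * C) := by
      rw [hSC, ← Matrix.mul_assoc, hGA, Matrix.mul_assoc]
    have l4 : (A * C)ᵀ * G = G * (A * C) := by
      have : (A * C)ᵀ * G = Cᵀ * (Aᵀ * G) := by rw [Matrix.transpose_mul, Matrix.mul_assoc]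
      rw [this, hGA]
      have h5 : Cᵀ * G = G * C := by
        rw [← hSC, ← hSs, hSC, Matrix.transpose_mul, hG]
      rw [← Matrix.mul_assoc, h5, Matrix.mul_assoc, hAC]
    have l5 : ∑ a, (Rm a b * A) a k = ∑ a, (A * Rm a b) a k := by simp only [hc]
    rw [l1, l2, l3, l4] at l5
    rw [hSC] at l5
    simp only [Matrix.mul_add, Matrix.mul_sub, Matrix.mul_smul, Matrix.add_apply, Matrix.sub_apply,
      Matrix.smul_apply, smul_eq_mul, Matrix.mul_one, ← Matrix.mul_assoc] at l5 ⊢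
    linarith
  have main2 : C.trace • A + C * A = (A * C).trace • 1 + A.trace • C - (2 : ℝ) • (A * C) := by
    have := congrArg (fun X => H * X) main
    simpa only [← Matrix.mul_assoc, hHG, Matrix.one_mul] using this
  have t1 : C.trace = A.trace / 2 := by
    rw [hC]
    simp [Matrix.trace_sub, Matrix.trace_smul]
    ring
  have t2 : (A * C).trace = A.trace ^ 2 / 2 - (A * A).trace := by
    rw [hC, Matrix.mul_sub]
    simp [Matrix.trace_sub, Matrix.trace_smul]
    ring
  rw [t1, t2, hC] at main2
  simp only [Matrix.mul_sub, Matrix.sub_mul, Matrix.mul_smul, Matrix.smul_mul, Matrix.mul_one,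
    Matrix.one_mul] at main2
  ext i j
  have e := congrFun (congrFun main2 i) j
  simp only [Matrix.add_apply, Matrix.sub_apply, Matrix.smul_apply, smul_eq_mul,
    Matrix.zero_apply] at e ⊢
  linarith

theorem trace_eq_of_soliton {κ c : ℝ} (h1 : A + κ • (A * A) = (c / 4) • 1)
    (h2 : κ * (A * A).trace = c) : A.trace = -c / 4 := by
  have := congrArg Matrix.trace h1
  simp [Matrix.trace_add, Matrix.trace_smul] at this
  linarith

/-- Completing the square: the shift is `s = 1/(2κ)` and the square is `μ = (κc + 1)/(4κ²)`. -/
theorem shift_sq_of_soliton {κ c : ℝ} (hc : c ≠ 0) (h1 : A + κ • (A * A) = (c / 4) • 1)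
    (h2 : κ * (A * A).trace = c) :
    ∃ s μ : ℝ, μ ≠ 0 ∧ (A + s • 1) * (A + s • 1) = μ • 1 ∧ ∀ X : Matrix (Fin 3) (Fin 3) ℝ,
      X + κ • (X * A + A * X) = 0 → X * (A + s • 1) + (A + s • 1) * X = 0 := by
  have hκ : κ ≠ 0 := by
    rintro rfl
    exact hc (by linarith)
  have ht := trace_eq_of_soliton h1 h2
  have hAA : A * A = κ⁻¹ • ((c / 4) • 1 - A) := by
    rw [← h1, add_sub_cancel_left, smul_smul, inv_mul_cancel₀ hκ, one_smul]
  have hsq : (A + (1 / (2 * κ)) • 1) * (A + (1 / (2 * κ)) • 1)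
      = ((κ * c + 1) / (4 * κ ^ 2)) • (1 : Matrix (Fin 3) (Fin 3) ℝ) := by
    rw [add_mul, mul_add, mul_add, hAA]
    simp only [Matrix.mul_smul, Matrix.smul_mul, Matrix.mul_one, Matrix.one_mul]
    ext i j
    simp only [Matrix.add_apply, Matrix.sub_apply, Matrix.smul_apply, smul_eq_mul]
    field_simp
    ring
  refine ⟨1 / (2 * κ), (κ * c + 1) / (4 * κ ^ 2), ?_, hsq, ?_⟩
  -- If `μ = 0` then `P` is nilpotent, so Cayley-Hamilton gives `tr P = 0`, that is `κc = 6`. But `μ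
  -- = 0` means `κc = -1`.
  · intro hμ
    rw [hμ, zero_smul] at hsq
    have hT : (A + (1 / (2 * κ)) • 1).trace = -c / 4 + 3 / (2 * κ) := by
      rw [Matrix.trace_add, ht]
      simp [Matrix.trace_smul]
      ring
    set P := A + (1 / (2 * κ)) • (1 : Matrix (Fin 3) (Fin 3) ℝ) with hP
    have hdet : P.det = 0 := by
      have := congrArg Matrix.det hsq
      rw [Matrix.det_mul, Matrix.det_zero] at this
      exact mul_self_eq_zero.1 this
    have hch := congrArg Matrix.trace (cayley_hamilton_fin_three P)
    simp only [hsq, hdet, Matrix.zero_mul, Matrix.trace_zero, smul_zero, zero_smul, sub_zero,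
      zero_add, Matrix.trace_smul, smul_eq_mul] at hch
    have hT0 : P.trace = 0 := by
      have : P.trace ^ 3 = 0 := by linarith
      exact pow_eq_zero_iff (by norm_num) |>.1 this
    rw [hT] at hT0
    have hk : κ * c + 1 = 0 := by
      rcases div_eq_zero_iff.1 hμ with h | h
      · exact h
      · exact absurd h (by positivity)
    field_simp at hT0
    linarith
  · intro X hX
    have : X * (A + (1 / (2 * κ)) • 1) + (A + (1 / (2 * κ)) • 1) * X
        = κ⁻¹ • (X + κ • (X * A + A * X)) := by
      rw [mul_add, add_mul]
      simp only [Matrix.mul_smul, Matrix.smul_mul, Matrix.mul_one, Matrix.one_mul]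
      ext i j
      simp only [Matrix.add_apply, Matrix.smul_apply, smul_eq_mul]
      field_simp
      ring
    rw [this, hX, smul_zero]

theorem eq_smul_one_of_soliton {κ c : ℝ} (hc : c ≠ 0) (h1 : A + κ • (A * A) = (c / 4) • 1)
    (h2 : κ * (A * A).trace = c)
    (h3 : (3 : ℝ) • (A * A) - (3 * A.trace) • A + (A.trace ^ 2 - (A * A).trace) • 1 = 0) :
    A = (-c / 12) • 1 ∧ κ * c = 48 := by
  have hκ : κ ≠ 0 := by
    rintro rfl
    exact hc (by linarith)
  have ht := trace_eq_of_soliton h1 h2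
  have hAA : A * A = κ⁻¹ • ((c / 4) • 1 - A) := by
    rw [← h1, add_sub_cancel_left, smul_smul, inv_mul_cancel₀ hκ, one_smul]
  have htt : (A * A).trace = c / κ := by field_simp; linarith
  -- Eliminating `A²` between the two quadratic equations leaves a linear one, which factors.
  have hfac : (κ * c / 4 - 1) • ((3 : ℝ) • A + (c / 4) • (1 : Matrix (Fin 3) (Fin 3) ℝ)) = 0 := by
    rw [ht, htt, hAA] at h3
    ext i j
    have e := congrFun (congrFun h3 i) j
    simp only [Matrix.add_apply, Matrix.sub_apply, Matrix.smul_apply, smul_eq_mul,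
      Matrix.zero_apply] at e ⊢
    field_simp at e
    linarith
  -- Once `A` is scalar, its trace gives `-c/12`, and `κ tr A² = c` becomes `κc²/48 = c`.
  have hscalar : ∀ r : ℝ, A = r • 1 → A = (-c / 12) • 1 ∧ κ * c = 48 := by
    intro r hr
    have e1 : 3 * r = -c / 4 := by
      rw [← ht, hr]
      simp [Matrix.trace_smul]
      ring
    have hr' : r = -c / 12 := by linarith
    refine ⟨by rw [← hr']; exact hr, ?_⟩
    rw [hr, hr'] at h2
    simp [Matrix.trace_smul] at h2
    have : c * (κ * c - 48) = 0 := by linarith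
    rcases mul_eq_zero.1 this with h | h
    · exact absurd h hc
    · linarith
  rcases smul_eq_zero.1 hfac with h | h
  -- If `κc = 4` the linear equation is void. The `A²` terms of Cayley-Hamilton then cancel, leaving
  -- `-(c²/32) A = det A`, so `A` is scalar here too.
  · have hk : κ = 4 / c := by field_simp; linarith
    have hAA' : A * A = (c / 4) • ((c / 4) • 1 - A) := by rw [hAA, hk, inv_div]
    have hAAA : A * A * A = (c / 4) • ((c / 4) • A - (c / 4) • ((c / 4) • 1 - A)) := by
      rw [← hAA', hAA', Matrix.smul_mul, Matrix.sub_mul, hAA', Matrix.smul_mul, Matrix.one_mul]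
    have hch := cayley_hamilton_fin_three A
    rw [hAAA, htt, ht, hAA'] at hch
    refine hscalar (-2 * A.det / (c / 4) ^ 2) ?_
    ext i j
    have e := congrFun (congrFun hch i) j
    simp only [Matrix.add_apply, Matrix.sub_apply, Matrix.smul_apply, smul_eq_mul,
      Matrix.zero_apply, hk] at e ⊢
    field_simp at e ⊢
    linarith
  · refine hscalar (-c / 12) ?_
    ext i j
    have e := congrFun (congrFun h i) j
    simp only [Matrix.add_apply, Matrix.smul_apply, smul_eq_mul, Matrix.zero_apply] at e ⊢
    linarith

end Endomorphisms

/-! ### Partial derivatives of functions and of matrix fields -/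

section Derivatives

variable {U : Set E3} {f h : E3 → ℝ} {x : E3}

theorem pd_congr (hU : IsOpen U) (hfh : Set.EqOn f h U) (hx : x ∈ U) (i : Fin 3) :
    pd i f x = pd i h x := by
  unfold pd
  rw [(hfh.eventuallyEq_of_mem (hU.mem_nhds hx)).fderiv_eq]

theorem pd_const (c : ℝ) (i : Fin 3) : pd i (fun _ => c) x = 0 := by
  simp [pd]

theorem pd_add (hf : DifferentiableAt ℝ f x) (hh : DifferentiableAt ℝ h x) (i : Fin 3) :
    pd i (fun y => f y + h y) x = pd i f x + pd i h x := by
  unfold pd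
  rw [fderiv_fun_add hf hh]
  rfl

theorem pd_sub (hf : DifferentiableAt ℝ f x) (hh : DifferentiableAt ℝ h x) (i : Fin 3) :
    pd i (fun y => f y - h y) x = pd i f x - pd i h x := by
  unfold pd
  rw [fderiv_fun_sub hf hh]
  rfl

theorem pd_mul (hf : DifferentiableAt ℝ f x) (hh : DifferentiableAt ℝ h x) (i : Fin 3) :
    pd i (fun y => f y * h y) x = pd i f x * h x + f x * pd i h x := by
  unfold pd
  rw [fderiv_fun_mul hf hh]
  simp
  ring

theorem pd_sum {ι : Type*} (s : Finset ι) {F : ι → E3 → ℝ}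
    (hF : ∀ k ∈ s, DifferentiableAt ℝ (F k) x) (i : Fin 3) :
    pd i (fun y => ∑ k ∈ s, F k y) x = ∑ k ∈ s, pd i (F k) x := by
  unfold pd
  rw [fderiv_fun_sum hF]
  simp

theorem contDiffOn_pd (hU : IsOpen U) (hf : ContDiffOn ℝ ∞ f U) (i : Fin 3) :
    ContDiffOn ℝ ∞ (pd i f) U :=
  (hf.fderiv_of_isOpen hU (by simp)).clm_apply contDiffOn_const

theorem pd_comm (hU : IsOpen U) (hf : ContDiffOn ℝ ∞ f U) (hx : x ∈ U) (i j : Fin 3) :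
    pd i (pd j f) x = pd j (pd i f) x := by
  have hat : ContDiffAt ℝ ∞ f x := hf.contDiffAt (hU.mem_nhds hx)
  have hd : DifferentiableAt ℝ (fderiv ℝ f) x :=
    ((hf.fderiv_of_isOpen (m := ∞) hU (by simp)).contDiffAt (hU.mem_nhds hx)).differentiableAt
      (by simp)
  have hs : IsSymmSndFDerivAt ℝ f x := hat.isSymmSndFDerivAt (by
    simpa using WithTop.coe_le_coe.2 (le_top : (2 : ℕ∞) ≤ ⊤))
  have e : ∀ i j, pd i (pd j f) x = fderiv ℝ (fderiv ℝ f) x (basisVec i) (basisVec j) := by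
    intro i j
    have : pd j f = fun y => fderiv ℝ f y (basisVec j) := rfl
    unfold pd
    rw [fderiv_clm_apply hd (by fun_prop)]
    simp
  rw [e, e]
  exact hs _ _

end Derivatives

section MatrixFields

/-- The matrix-valued function `F` has smooth entries on `U`. -/
def SmoothEntries (F : E3 → Matrix (Fin 3) (Fin 3) ℝ) (U : Set E3) : Prop :=
  ∀ a b, ContDiffOn ℝ ∞ (fun y => F y a b) U

/-- The entrywise partial derivative of a matrix-valued function. -/
noncomputable def matPd (i : Fin 3) (F : E3 → Matrix (Fin 3) (Fin 3) ℝ) (x : E3) :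
    Matrix (Fin 3) (Fin 3) ℝ :=
  Matrix.of fun a b => pd i (fun y => F y a b) x

variable {U : Set E3} {F K : E3 → Matrix (Fin 3) (Fin 3) ℝ} {x : E3}

theorem SmoothEntries.differentiableAt (hF : SmoothEntries F U) (hU : IsOpen U) (hx : x ∈ U)
    (a b : Fin 3) : DifferentiableAt ℝ (fun y => F y a b) x :=
  ((hF a b).contDiffAt (hU.mem_nhds hx)).differentiableAt (by simp)

theorem SmoothEntries.mul (hF : SmoothEntries F U) (hK : SmoothEntries K U) :
    SmoothEntries (fun y => F y * K y) U := by
  intro a b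
  simp only [Matrix.mul_apply]
  exact ContDiffOn.sum fun c _ => (hF a c).mul (hK c b)

theorem SmoothEntries.add (hF : SmoothEntries F U) (hK : SmoothEntries K U) :
    SmoothEntries (fun y => F y + K y) U := fun a b => (hF a b).add (hK a b)

theorem SmoothEntries.sub (hF : SmoothEntries F U) (hK : SmoothEntries K U) :
    SmoothEntries (fun y => F y - K y) U := fun a b => (hF a b).sub (hK a b)

theorem SmoothEntries.transpose (hF : SmoothEntries F U) :
    SmoothEntries (fun y => (F y)ᵀ) U := fun a b => hF b a

theorem SmoothEntries.smul {f : E3 → ℝ} (hf : ContDiffOn ℝ ∞ f U) (hF : SmoothEntries F U) :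
    SmoothEntries (fun y => f y • F y) U := fun a b => hf.mul (hF a b)

theorem SmoothEntries.matPd (hU : IsOpen U) (hF : SmoothEntries F U) (i : Fin 3) :
    SmoothEntries (matPd i F) U := fun a b => contDiffOn_pd hU (hF a b) i

theorem SmoothEntries.det (hF : SmoothEntries F U) : ContDiffOn ℝ ∞ (fun y => (F y).det) U := by
  simp only [Matrix.det_fin_three]
  have h := fun a b => hF a b
  exact (((((((h 0 0).mul (h 1 1)).mul (h 2 2)).sub (((h 0 0).mul (h 1 2)).mul (h 2 1))).sub
    (((h 0 1).mul (h 1 0)).mul (h 2 2))).add (((h 0 1).mul (h 1 2)).mul (h 2 0))).add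
    (((h 0 2).mul (h 1 0)).mul (h 2 1))).sub (((h 0 2).mul (h 1 1)).mul (h 2 0))

theorem SmoothEntries.inv (hF : SmoothEntries F U) (hd : ∀ y ∈ U, (F y).det ≠ 0) :
    SmoothEntries (fun y => (F y)⁻¹) U := by
  have hadj : SmoothEntries (fun y => (F y).adjugate) U := by
    intro a b
    simp only [Matrix.adjugate_fin_three]
    fin_cases a <;> fin_cases b <;> simp <;>
      first
      | exact ((hF _ _).mul (hF _ _)).sub ((hF _ _).mul (hF _ _))
      | exact (((hF _ _).mul (hF _ _)).neg).add ((hF _ _).mul (hF _ _))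
  have : (fun y => (F y)⁻¹) = fun y => (F y).det⁻¹ • (F y).adjugate := by
    funext y
    rw [Matrix.inv_def, Ring.inverse_eq_inv']
  rw [this]
  exact SmoothEntries.smul (hF.det.inv hd) hadj

theorem matPd_congr (hU : IsOpen U) (h : ∀ y ∈ U, F y = K y) (hx : x ∈ U) (i : Fin 3) :
    matPd i F x = matPd i K x := by
  ext a b
  exact pd_congr hU (fun y hy => by simp only [h y hy]) hx i

theorem matPd_mul (hU : IsOpen U) (hF : SmoothEntries F U) (hK : SmoothEntries K U) (hx : x ∈ U)
    (i : Fin 3) :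
    matPd i (fun y => F y * K y) x = matPd i F x * K x + F x * matPd i K x := by
  ext a b
  simp only [matPd, Matrix.of_apply, Matrix.add_apply, Matrix.mul_apply]
  rw [pd_sum (F := fun c y => F y a c * K y c b) _ fun c _ =>
    (hF.differentiableAt hU hx a c).mul (hK.differentiableAt hU hx c b), ← Finset.sum_add_distrib]
  exact Finset.sum_congr rfl fun c _ =>
    pd_mul (hF.differentiableAt hU hx a c) (hK.differentiableAt hU hx c b) i

theorem matPd_add (hU : IsOpen U) (hF : SmoothEntries F U) (hK : SmoothEntries K U) (hx : x ∈ U)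
    (i : Fin 3) : matPd i (fun y => F y + K y) x = matPd i F x + matPd i K x := by
  ext a b
  exact pd_add (hF.differentiableAt hU hx a b) (hK.differentiableAt hU hx a b) i

theorem matPd_sub (hU : IsOpen U) (hF : SmoothEntries F U) (hK : SmoothEntries K U) (hx : x ∈ U)
    (i : Fin 3) : matPd i (fun y => F y - K y) x = matPd i F x - matPd i K x := by
  ext a b
  exact pd_sub (hF.differentiableAt hU hx a b) (hK.differentiableAt hU hx a b) i

theorem matPd_const_smul (hU : IsOpen U) (hF : SmoothEntries F U) (hx : x ∈ U) (c : ℝ)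
    (i : Fin 3) : matPd i (fun y => c • F y) x = c • matPd i F x := by
  ext a b
  have := pd_mul (f := fun _ => c) (differentiableAt_const c) (hF.differentiableAt hU hx a b) i
  simpa [matPd, pd_const] using this

theorem matPd_const (C : Matrix (Fin 3) (Fin 3) ℝ) (i : Fin 3) : matPd i (fun _ => C) x = 0 := by
  ext a b
  exact pd_const _ i

theorem matPd_transpose (i : Fin 3) : matPd i (fun y => (F y)ᵀ) x = (matPd i F x)ᵀ := rfl

theorem trace_matPd (hU : IsOpen U) (hF : SmoothEntries F U) (hx : x ∈ U) (i : Fin 3) :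
    (matPd i F x).trace = pd i (fun y => (F y).trace) x := by
  simp only [Matrix.trace, Matrix.diag_apply]
  rw [pd_sum (F := fun c y => F y c c) _ fun c _ => hF.differentiableAt hU hx c c]
  rfl

theorem matPd_comm (hU : IsOpen U) (hF : SmoothEntries F U) (hx : x ∈ U) (i j : Fin 3) :
    matPd i (matPd j F) x = matPd j (matPd i F) x := by
  ext a b
  exact pd_comm hU (hF a b) hx i j

end MatrixFields

/-! ### Levi-Civita connection and symmetries of its curvature -/

section Connection

/-- `G` consists of the components of a smooth nondegenerate symmetric form on the open set `U`. -/
structure IsMetricOn (G : E3 → Matrix (Fin 3) (Fin 3) ℝ) (U : Set E3) : Prop where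
  isOpen : IsOpen U
  smooth : SmoothEntries G U
  symm : ∀ x ∈ U, (G x)ᵀ = G x
  det_ne_zero : ∀ x ∈ U, (G x).det ≠ 0

/-- The connection matrix `(Γ_i)^l_k = Γ^l_{ik}`. -/
noncomputable def connMat (G : E3 → Matrix (Fin 3) (Fin 3) ℝ) (i : Fin 3) (x : E3) :
    Matrix (Fin 3) (Fin 3) ℝ :=
  Matrix.of fun l k => christoffel G l i k x

/-- The matrix of the endomorphism `R(∂_i, ∂_j)`. -/
noncomputable def curvMat (G : E3 → Matrix (Fin 3) (Fin 3) ℝ) (i j : Fin 3) (x : E3) :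
    Matrix (Fin 3) (Fin 3) ℝ :=
  Matrix.of fun l k => riemannUp G l i j k x

variable {G : E3 → Matrix (Fin 3) (Fin 3) ℝ} {U : Set E3} {x : E3}

theorem riemann_eq (i j k l : Fin 3) : riemann G i j k l x = (G x * curvMat G i j x) l k := rfl

theorem curvMat_eq (i j : Fin 3) :
    curvMat G i j x = matPd i (connMat G j) x - matPd j (connMat G i) x
      + (connMat G i x * connMat G j x - connMat G j x * connMat G i x) := by
  ext l k
  simp only [curvMat, riemannUp, Matrix.of_apply, Matrix.add_apply, Matrix.sub_apply,
    Matrix.mul_apply, Finset.sum_sub_distrib]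
  rfl

theorem curvMat_swap (i j : Fin 3) : curvMat G i j x = -curvMat G j i x := by
  rw [curvMat_eq, curvMat_eq]
  abel

theorem riemann_swap_left (i j k l : Fin 3) : riemann G i j k l x = -riemann G j i k l x := by
  rw [riemann_eq, riemann_eq, curvMat_swap i j, Matrix.mul_neg, Matrix.neg_apply]

namespace IsMetricOn

variable (hG : IsMetricOn G U)

include hG

theorem inv_mul (hx : x ∈ U) : (G x)⁻¹ * G x = 1 :=
  Matrix.nonsing_inv_mul _ (isUnit_iff_ne_zero.2 (hG.det_ne_zero x hx))

theorem mul_inv (hx : x ∈ U) : G x * (G x)⁻¹ = 1 :=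
  Matrix.mul_nonsing_inv _ (isUnit_iff_ne_zero.2 (hG.det_ne_zero x hx))

theorem inv_symm (hx : x ∈ U) : ((G x)⁻¹)ᵀ = (G x)⁻¹ := by
  rw [Matrix.transpose_nonsing_inv, hG.symm x hx]

theorem apply_comm (hx : x ∈ U) (i j : Fin 3) : G x i j = G x j i :=
  congrFun (congrFun (hG.symm x hx) j) i

theorem pd_apply_comm (hx : x ∈ U) (a i j : Fin 3) :
    pd a (fun y => G y i j) x = pd a (fun y => G y j i) x :=
  pd_congr hG.isOpen (fun _ hy => hG.apply_comm hy i j) hx a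

theorem smooth_connMat (i : Fin 3) : SmoothEntries (connMat G i) U := by
  have hi := hG.smooth.inv hG.det_ne_zero
  intro l k
  simp only [connMat, Matrix.of_apply, christoffel]
  refine contDiffOn_const.mul (ContDiffOn.sum fun m _ => ?_)
  exact (hi l m).mul (((contDiffOn_pd hG.isOpen (hG.smooth k m) i).add
    (contDiffOn_pd hG.isOpen (hG.smooth i m) k)).sub (contDiffOn_pd hG.isOpen (hG.smooth i k) m))

theorem christoffel_comm (hx : x ∈ U) (k i j : Fin 3) :
    christoffel G k i j x = christoffel G k j i x := by
  simp only [christoffel]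
  congr 1
  refine Finset.sum_congr rfl fun l _ => ?_
  rw [hG.pd_apply_comm hx l i j]
  ring

theorem lower_christoffel (hx : x ∈ U) (m i j : Fin 3) :
    ∑ k, G x m k * christoffel G k i j x
      = (1 / 2) * (pd i (fun y => G y j m) x + pd j (fun y => G y i m) x
        - pd m (fun y => G y i j) x) := by
  set v : Fin 3 → ℝ := fun l => pd i (fun y => G y j l) x + pd j (fun y => G y i l) x
    - pd l (fun y => G y i j) x with hv
  have e : ∑ k, G x m k * christoffel G k i j x
      = (1 / 2) * (G x *ᵥ ((G x)⁻¹ *ᵥ v)) m := by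
    simp only [christoffel, inv, Matrix.mulVec, dotProduct, Fin.sum_univ_three, hv]
    ring
  rw [e, Matrix.mulVec_mulVec, hG.mul_inv hx, Matrix.one_mulVec]

/-- This is metric compatibility `∇g = 0` in matrix form. -/
theorem matPd_metric (hx : x ∈ U) (a : Fin 3) :
    matPd a G x = G x * connMat G a x + (connMat G a x)ᵀ * G x := by
  ext i j
  have e1 : (G x * connMat G a x) i j = ∑ k, G x i k * christoffel G k a j x := rfl
  have e2 : ((connMat G a x)ᵀ * G x) i j = ∑ k, G x j k * christoffel G k a i x := by
    simp only [Matrix.mul_apply, Matrix.transpose_apply, connMat, Matrix.of_apply]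
    exact Finset.sum_congr rfl fun k _ => by rw [hG.apply_comm hx k j, mul_comm]
  rw [Matrix.add_apply, e1, e2, hG.lower_christoffel hx, hG.lower_christoffel hx,
    hG.pd_apply_comm hx a j i]
  simp only [matPd, Matrix.of_apply]
  ring

theorem smooth_curvMat (i j : Fin 3) : SmoothEntries (curvMat G i j) U := by
  have : curvMat G i j = fun x => matPd i (connMat G j) x - matPd j (connMat G i) x
      + (connMat G i x * connMat G j x - connMat G j x * connMat G i x) :=
    funext fun x => curvMat_eq i j
  rw [this]
  have h := hG.smooth_connMat
  exact (((h j).matPd hG.isOpen i).sub ((h i).matPd hG.isOpen j)).add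
    (((h i).mul (h j)).sub ((h j).mul (h i)))

theorem smooth_riemann (i j k l : Fin 3) : ContDiffOn ℝ ∞ (riemann G i j k l) U :=
  hG.smooth.mul (hG.smooth_curvMat i j) l k

/-- Skewness of `R(∂_i, ∂_j)`: differentiate `∇g = 0` once more and use that second partial
derivatives of `G` commute. -/
theorem metric_curvMat (hx : x ∈ U) (i j : Fin 3) :
    G x * curvMat G i j x + (curvMat G i j x)ᵀ * G x = 0 := by
  have hΓ := hG.smooth_connMat
  have second : ∀ i j, matPd i (matPd j G) x
      = (G x * connMat G i x + (connMat G i x)ᵀ * G x) * connMat G j x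
        + G x * matPd i (connMat G j) x
        + ((matPd i (connMat G j) x)ᵀ * G x
          + (connMat G j x)ᵀ * (G x * connMat G i x + (connMat G i x)ᵀ * G x)) := by
    intro i j
    rw [matPd_congr hG.isOpen (fun y hy => hG.matPd_metric hy j) hx i,
      matPd_add hG.isOpen (hG.smooth.mul (hΓ j)) ((hΓ j).transpose.mul hG.smooth) hx,
      matPd_mul hG.isOpen hG.smooth (hΓ j) hx, matPd_mul hG.isOpen (hΓ j).transpose hG.smooth hx,
      matPd_transpose, hG.matPd_metric hx i]
  have h := matPd_comm hG.isOpen hG.smooth hx i j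
  rw [second, second] at h
  rw [curvMat_eq]
  simp only [Matrix.transpose_add, Matrix.transpose_sub, Matrix.transpose_mul]
  rw [← sub_eq_zero] at h
  rw [← h]
  noncomm_ring

/-- A parallel endomorphism field commutes with the curvature. -/
theorem curvMat_commute {A : E3 → Matrix (Fin 3) (Fin 3) ℝ} (hA : SmoothEntries A U)
    (hpar : ∀ y ∈ U, ∀ a, matPd a A y = A y * connMat G a y - connMat G a y * A y)
    (hx : x ∈ U) (i j : Fin 3) : curvMat G i j x * A x = A x * curvMat G i j x := by
  have hΓ := hG.smooth_connMat
  -- Antisymmetrising this second derivative in `i, j` leaves only the commutator of `A` with the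
  -- curvature.
  have second : ∀ i j, matPd i (matPd j A) x
      = (A x * connMat G i x - connMat G i x * A x) * connMat G j x
        + A x * matPd i (connMat G j) x
        - (matPd i (connMat G j) x * A x
          + connMat G j x * (A x * connMat G i x - connMat G i x * A x)) := by
    intro i j
    rw [matPd_congr hG.isOpen (fun y hy => hpar y hy j) hx i,
      matPd_sub hG.isOpen (hA.mul (hΓ j)) ((hΓ j).mul hA) hx,
      matPd_mul hG.isOpen hA (hΓ j) hx, matPd_mul hG.isOpen (hΓ j) hA hx, hpar x hx i]
  have h := matPd_comm hG.isOpen hA hx i j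
  rw [second, second, ← sub_eq_zero] at h
  rw [curvMat_eq, ← sub_eq_zero, ← neg_eq_zero, ← h]
  noncomm_ring

theorem riemann_swap_right (hx : x ∈ U) (i j k l : Fin 3) :
    riemann G i j k l x = -riemann G i j l k x := by
  have h := congrFun (congrFun (hG.metric_curvMat hx i j) l) k
  have e : ((curvMat G i j x)ᵀ * G x) l k = (G x * curvMat G i j x) k l := by
    rw [← Matrix.transpose_apply (G x * curvMat G i j x), Matrix.transpose_mul, hG.symm x hx]
  rw [Matrix.add_apply, e, Matrix.zero_apply] at h
  rw [riemann_eq, riemann_eq]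
  linarith

theorem riemann_bianchi (hx : x ∈ U) (i j k l : Fin 3) :
    riemann G i j k l x + riemann G j k i l x + riemann G k i j l x = 0 := by
  have hp : ∀ a l i j, pd a (christoffel G l i j) x = pd a (christoffel G l j i) x :=
    fun a l i j => pd_congr hG.isOpen (fun y hy => hG.christoffel_comm hy l i j) hx a
  have hc := hG.christoffel_comm hx
  have hup : ∀ l, riemannUp G l i j k x + riemannUp G l j k i x + riemannUp G l k i j x = 0 := by
    intro l
    simp only [riemannUp]
    rw [hp i l j k, hp j l i k, hp k l i j]
    simp only [Fin.sum_univ_three, hc _ j i, hc _ k i, hc _ k j]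
    ring
  simp only [riemann, ← Finset.sum_add_distrib, ← mul_add, hup]
  simp

theorem riemann_pair_symm (hx : x ∈ U) (i j k l : Fin 3) :
    riemann G i j k l x = riemann G k l i j x :=
  pair_symm_of_bianchi (R := fun i j k l => riemann G i j k l x) riemann_swap_left
    (hG.riemann_swap_right hx) (hG.riemann_bianchi hx) i j k l

end IsMetricOn

end Connection

/-! ### The soliton equations in a coordinate domain -/

section Local

/-- The covariant derivative `∇_{∂_a} B` of a bilinear form `B`. -/
noncomputable def nablaMat (G B : E3 → Matrix (Fin 3) (Fin 3) ℝ) (a : Fin 3) (x : E3) :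
    Matrix (Fin 3) (Fin 3) ℝ :=
  matPd a B x - B x * connMat G a x - (connMat G a x)ᵀ * B x

/-- The matrix `N` with `R_{ijkl} = - ε_{ijc} ε_{kld} N^{cd}`. -/
noncomputable def curvDual (G : E3 → Matrix (Fin 3) (Fin 3) ℝ) (x : E3) :
    Matrix (Fin 3) (Fin 3) ℝ :=
  Matrix.of fun c d => -riemann G (c + 1) (c + 2) (d + 1) (d + 2) x

/-- The field of curvature endomorphisms. -/
noncomputable def curvField (G : E3 → Matrix (Fin 3) (Fin 3) ℝ) (x : E3) :
    Matrix (Fin 3) (Fin 3) ℝ := curvEndo (G x) (curvDual G x)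

variable {G S : E3 → Matrix (Fin 3) (Fin 3) ℝ} {U : Set E3} {x : E3}

theorem kulkarni_smul_self (K : ℝ) (g : Matrix (Fin 3) (Fin 3) ℝ) (i j k l : Fin 3) :
    kulkarni ((K / 2) • g) g i j k l = K * (g i l * g j k - g i k * g j l) := by
  simp only [kulkarni, Matrix.smul_apply, smul_eq_mul]
  ring

namespace IsMetricOn

variable (hG : IsMetricOn G U)

include hG

/-- Leibniz rule together with `∇g = 0`: only the first factor is differentiated. -/
theorem nablaRiemann_eq_kulkarni (hS : SmoothEntries S U)
    (hR : ∀ y ∈ U, ∀ i j k l, riemann G i j k l y = kulkarni (S y) (G y) i j k l)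
    (hx : x ∈ U) (a i j k l : Fin 3) :
    nablaRiemann G a i j k l x = kulkarni (nablaMat G S a x) (G x) i j k l := by
  have dS := fun i j => hS.differentiableAt hG.isOpen hx i j
  have dG := fun i j => hG.smooth.differentiableAt hG.isOpen hx i j
  have dm : ∀ i j k l, DifferentiableAt ℝ (fun y => S y i j * G y k l) x :=
    fun i j k l => (dS i j).fun_mul (dG k l)
  have hpd : pd a (riemann G i j k l) x
      = pd a (fun y => S y i l) x * G x j k + S x i l * pd a (fun y => G y j k) x
        + (pd a (fun y => S y j k) x * G x i l + S x j k * pd a (fun y => G y i l) x)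
        - (pd a (fun y => S y i k) x * G x j l + S x i k * pd a (fun y => G y j l) x)
        - (pd a (fun y => S y j l) x * G x i k + S x j l * pd a (fun y => G y i k) x) := by
    rw [pd_congr (h := fun y => S y i l * G y j k + S y j k * G y i l - S y i k * G y j l
        - S y j l * G y i k) hG.isOpen (fun y hy => hR y hy i j k l) hx,
      pd_sub (((dm i l j k).fun_add (dm j k i l)).fun_sub (dm i k j l)) (dm j l i k),
      pd_sub ((dm i l j k).fun_add (dm j k i l)) (dm i k j l), pd_add (dm i l j k) (dm j k i l),
      pd_mul (dS i l) (dG j k), pd_mul (dS j k) (dG i l), pd_mul (dS i k) (dG j l),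
      pd_mul (dS j l) (dG i k)]
  have hmet : ∀ i j, pd a (fun y => G y i j) x = ∑ m, G x i m * christoffel G m a j x
      + ∑ m, christoffel G m a i x * G x m j := by
    intro i j
    have := congrFun (congrFun (hG.matPd_metric hx a) i) j
    simpa only [matPd, Matrix.of_apply, Matrix.add_apply, Matrix.mul_apply,
      Matrix.transpose_apply, connMat] using this
  rw [nablaRiemann, hpd]
  simp only [hR x hx, hmet]
  simp only [kulkarni, nablaMat, Matrix.sub_apply, Matrix.mul_apply, Matrix.transpose_apply,
    connMat, matPd, Matrix.of_apply, Fin.sum_univ_three]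
  ring

theorem curvDual_symm (hx : x ∈ U) : (curvDual G x)ᵀ = curvDual G x := by
  ext c d
  simp only [curvDual, Matrix.transpose_apply, Matrix.of_apply]
  rw [hG.riemann_pair_symm hx]

theorem riemann_eq_ofDual (hx : x ∈ U) (i j k l : Fin 3) :
    riemann G i j k l x = ofDual (curvDual G x) i j k l :=
  eq_ofDual (R := fun i j k l => riemann G i j k l x) riemann_swap_left
    (hG.riemann_swap_right hx) i j k l

theorem mul_curvField_symm (hx : x ∈ U) : (G x * curvField G x)ᵀ = G x * curvField G x :=
  mul_curvEndo_symm (hG.symm x hx) (hG.curvDual_symm hx)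

theorem smooth_curvField : SmoothEntries (curvField G) U := by
  have hN : SmoothEntries (curvDual G) U := fun c d => (hG.smooth_riemann _ _ _ _).neg
  exact SmoothEntries.smul (hG.smooth.det.inv hG.det_ne_zero) (hN.mul hG.smooth)

theorem riemann_eq_kulkarni (hx : x ∈ U) (i j k l : Fin 3) :
    riemann G i j k l x
      = kulkarni (((curvField G x).trace / 2) • G x - G x * curvField G x) (G x) i j k l := by
  rw [hG.riemann_eq_ofDual hx]
  exact ofDual_eq_kulkarni (hG.symm x hx) (hG.det_ne_zero x hx) (hG.curvDual_symm hx) i j k l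

theorem ricci_eq (hx : x ∈ U) (j k : Fin 3) :
    ricci G j k x = (curvField G x).trace * G x j k - (G x * curvField G x) j k := by
  simp only [ricci, hG.riemann_eq_ofDual hx, inv]
  rw [contract_ofDual]
  exact leviContract_inv (hG.symm x hx) rfl (hG.det_ne_zero x hx) (hG.curvDual_symm hx) j k

theorem scalarCurvature_eq (hx : x ∈ U) :
    scalarCurvature G x = 2 * (curvField G x).trace := by
  simp only [scalarCurvature, hG.ricci_eq hx, inv]
  rw [contract_metric rfl (hG.det_ne_zero x hx) _ (hG.symm x hx) (hG.mul_curvField_symm hx)]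
  ring

theorem riemannSquare_eq (hx : x ∈ U) (a b : Fin 3) :
    riemannSquare G a b x = (curvField G x * curvField G x).trace * G x a b
      - (G x * (curvField G x * curvField G x)) a b := by
  simp only [riemannSquare, hG.riemann_eq_ofDual hx, inv]
  exact contract_ofDual_sq_eq (hG.symm x hx) rfl (hG.det_ne_zero x hx) (hG.curvDual_symm hx) a b

theorem riemannNormSq_eq (hx : x ∈ U) :
    riemannNormSq G x = (curvField G x * curvField G x).trace := by
  have e : riemannNormSq G x = (1 / 2) * ∑ a, ∑ b, (G x)⁻¹ a b * riemannSquare G a b x := by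
    simp only [riemannNormSq, riemannSquare, inv, Finset.mul_sum]
    refine Finset.sum_congr rfl fun a _ => Finset.sum_congr rfl fun b _ =>
      Finset.sum_congr rfl fun i _ => Finset.sum_congr rfl fun j _ =>
      Finset.sum_congr rfl fun k _ => Finset.sum_congr rfl fun p _ =>
      Finset.sum_congr rfl fun q _ => Finset.sum_congr rfl fun r _ => ?_
    ring
  have hs : (G x * (curvField G x * curvField G x))ᵀ = G x * (curvField G x * curvField G x) := by
    have h1 := hG.mul_curvField_symm hx
    have h2 : (curvField G x)ᵀ * G x = G x * curvField G x := by
      rw [← h1, Matrix.transpose_mul, hG.symm x hx]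
    rw [← Matrix.mul_assoc, Matrix.transpose_mul, h1, ← Matrix.mul_assoc, h2]
  rw [e]
  simp only [hG.riemannSquare_eq hx]
  rw [contract_metric rfl (hG.det_ne_zero x hx) _ (hG.symm x hx) hs]
  ring

theorem nablaMat_mul {A : E3 → Matrix (Fin 3) (Fin 3) ℝ} (hA : SmoothEntries A U) (hx : x ∈ U)
    (a : Fin 3) :
    nablaMat G (fun y => G y * A y) a x
      = G x * (matPd a A x + connMat G a x * A x - A x * connMat G a x) := by
  rw [nablaMat, matPd_mul hG.isOpen hG.smooth hA hx, hG.matPd_metric hx]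
  noncomm_ring

theorem nablaMat_smul_sub {B : E3 → Matrix (Fin 3) (Fin 3) ℝ} (hB : SmoothEntries B U)
    (hx : x ∈ U) (t : ℝ) (a : Fin 3) :
    nablaMat G (fun y => t • G y - B y) a x = -nablaMat G B a x := by
  have ht : SmoothEntries (fun y => t • G y) U := SmoothEntries.smul contDiffOn_const hG.smooth
  rw [nablaMat, matPd_sub hG.isOpen ht hB hx, matPd_const_smul hG.isOpen hG.smooth hx,
    hG.matPd_metric hx, nablaMat]
  simp only [smul_add, Matrix.sub_mul, Matrix.mul_sub, Matrix.smul_mul, Matrix.mul_smul]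
  abel

theorem nablaMat_symm {B : E3 → Matrix (Fin 3) (Fin 3) ℝ} (hB : ∀ y ∈ U, (B y)ᵀ = B y)
    (hx : x ∈ U) (a : Fin 3) : (nablaMat G B a x)ᵀ = nablaMat G B a x := by
  have : (matPd a B x)ᵀ = matPd a B x := by
    rw [← matPd_transpose]
    exact matPd_congr hG.isOpen hB hx a
  simp only [nablaMat, Matrix.transpose_sub, Matrix.transpose_mul, this, hB x hx,
    Matrix.transpose_transpose]
  abel

/-- In dimension three, the equations of a torsionless soliton with constant dilaton force the
curvature endomorphism to be a fixed multiple of the identity. -/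
theorem curvField_of_constant_dilaton {κ c : ℝ} (hc : c ≠ 0)
    (hein : ∀ y ∈ U, ∀ i j,
      ricci G i j y - (1 / 2) * c * G y i j + κ * riemannSquare G i j y = 0)
    (hym : ∀ y ∈ U, ∀ j k l, codiffRiemann G j k l y = 0)
    (hdil : ∀ y ∈ U, κ * riemannNormSq G y = c) (hx : x ∈ U) :
    curvField G x = (-c / 12) • 1 ∧ κ * c = 48 := by
  have h2 : ∀ y ∈ U, κ * (curvField G y * curvField G y).trace = c := fun y hy => by
    rw [← hG.riemannNormSq_eq hy, hdil y hy]
  have h1 : ∀ y ∈ U, curvField G y + κ • (curvField G y * curvField G y)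
      = (c / 4) • (1 : Matrix (Fin 3) (Fin 3) ℝ) := by
    intro y hy
    -- The Einstein equation, with `κ tr A² = c` inserted and one index raised; its trace then
    -- yields `tr A = -c/4`.
    have e0 : curvField G y + κ • (curvField G y * curvField G y)
        = ((curvField G y).trace + c / 2) • (1 : Matrix (Fin 3) (Fin 3) ℝ) := by
      have e : G y * (curvField G y + κ • (curvField G y * curvField G y))
          = G y * (((curvField G y).trace + c / 2) • (1 : Matrix (Fin 3) (Fin 3) ℝ)) := by
        ext i j
        have := hein y hy i j
        rw [hG.ricci_eq hy, hG.riemannSquare_eq hy] at this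
        have h2' := h2 y hy
        simp only [Matrix.mul_add, Matrix.mul_smul, Matrix.mul_one, Matrix.add_apply,
          Matrix.smul_apply, smul_eq_mul]
        linear_combination -this + G y i j * h2'
      have := congrArg (fun X => (G y)⁻¹ * X) e
      simpa only [← Matrix.mul_assoc, hG.inv_mul hy, Matrix.one_mul] using this
    have et := congrArg Matrix.trace e0
    simp [Matrix.trace_add, Matrix.trace_smul, h2 y hy] at et
    rw [e0]
    congr 1
    linarith
  have htr : ∀ y ∈ U, (curvField G y).trace = -c / 4 := fun y hy =>
    trace_eq_of_soliton (h1 y hy) (h2 y hy)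
  have hA := hG.smooth_curvField
  have hpar : ∀ y ∈ U, ∀ a,
      matPd a (curvField G) y + connMat G a y * curvField G y - curvField G y * connMat G a y
        = 0 := by
    intro y hy
    -- `X a` is the covariant derivative `∇_a A`.
    set X : Fin 3 → Matrix (Fin 3) (Fin 3) ℝ := fun a =>
      matPd a (curvField G) y + connMat G a y * curvField G y - curvField G y * connMat G a y
      with hX
    have hHX : ∀ a, (G y)⁻¹ * (G y * X a) = X a := fun a => by
      rw [← Matrix.mul_assoc, hG.inv_mul hy, Matrix.one_mul]
    have hTX : ∀ a, nablaMat G (fun y => G y * curvField G y) a y = G y * X a :=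
      fun a => hG.nablaMat_mul hA hy a
    have hTs : ∀ a, (G y * X a)ᵀ = G y * X a := fun a => by
      rw [← hTX]
      exact hG.nablaMat_symm (fun z hz => hG.mul_curvField_symm hz) hy a
    have htrX : ∀ a, ((G y)⁻¹ * (G y * X a)).trace = 0 := fun a => by
      rw [hHX, hX]
      simp only [Matrix.trace_sub, Matrix.trace_add, Matrix.trace_mul_comm (connMat G a y)]
      rw [trace_matPd hG.isOpen hA hy, pd_congr (h := fun _ => -c / 4) hG.isOpen htr hy, pd_const]
      ring
    have hdiv : ∀ j k l, ∑ a, ∑ b, (G y)⁻¹ a b * kulkarni (G y * X a) (G y) b j k l = 0 := by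
      intro j k l
      -- Since `tr A / 2 = -c/8` is constant, the Schouten tensor has derivative `-∇(gA)`, so the
      -- Yang-Mills equation concerns `∇(gA)` alone.
      have hS : SmoothEntries (fun z => (-c / 8) • G z - G z * curvField G z) U :=
        (SmoothEntries.smul contDiffOn_const hG.smooth).sub (hG.smooth.mul hA)
      have hR : ∀ z ∈ U, ∀ i j k l, riemann G i j k l z
          = kulkarni ((-c / 8) • G z - G z * curvField G z) (G z) i j k l := by
        intro z hz i j k l
        rw [hG.riemann_eq_kulkarni hz, htr z hz, show -c / 4 / 2 = -c / 8 by ring]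
      have := hym y hy j k l
      simp only [codiffRiemann, hG.nablaRiemann_eq_kulkarni hS hR hy, inv,
        hG.nablaMat_smul_sub (hG.smooth.mul hA) hy, hTX] at this
      rw [← this, ← Finset.sum_neg_distrib]
      refine Finset.sum_congr rfl fun a _ => ?_
      rw [← Finset.sum_neg_distrib]
      refine Finset.sum_congr rfl fun b _ => ?_
      simp only [kulkarni, Matrix.neg_apply]
      ring
    have hcod := codazzi_of_divergence (hG.inv_mul hy) (hG.inv_symm hy) (hG.symm y hy) hTs htrX hdiv
    obtain ⟨s, μ, hμ, hsq, hanti⟩ := shift_sq_of_soliton hc (h1 y hy) (h2 y hy)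
    have hGA : (curvField G y)ᵀ * G y = G y * curvField G y := by
      rw [← hG.mul_curvField_symm hy, Matrix.transpose_mul, hG.symm y hy]
    have hder : ∀ a, X a + κ • (X a * curvField G y + curvField G y * X a) = 0 := by
      intro a
      have e := matPd_congr hG.isOpen h1 hy a
      rw [matPd_add hG.isOpen hA (SmoothEntries.smul contDiffOn_const (hA.mul hA)) hy,
        matPd_const_smul hG.isOpen (hA.mul hA) hy, matPd_mul hG.isOpen hA hA hy, matPd_const] at e
      -- `A + κA²` is a scalar, so the connection terms cancel and its partial derivative is also
      -- its covariant derivative.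
      have comm : connMat G a y * (curvField G y + κ • (curvField G y * curvField G y))
          - (curvField G y + κ • (curvField G y * curvField G y)) * connMat G a y = 0 := by
        rw [h1 y hy]
        simp
      have e2 : X a + κ • (X a * curvField G y + curvField G y * X a)
          = (matPd a (curvField G) y + κ • (matPd a (curvField G) y * curvField G y
              + curvField G y * matPd a (curvField G) y))
            + (connMat G a y * (curvField G y + κ • (curvField G y * curvField G y))
          - (curvField G y + κ • (curvField G y * curvField G y)) * connMat G a y) := by
        rw [hX]
        simp only [Matrix.mul_add, Matrix.add_mul, Matrix.sub_mul, Matrix.mul_sub, smul_add,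
          smul_sub, Matrix.smul_mul, Matrix.mul_smul, ← Matrix.mul_assoc]
        abel
      rw [e2, e, comm, add_zero]
    have hT0 := eq_zero_of_anticommute (T := fun a => G y * X a) hμ hsq hTs hcod (fun a => by
      have e := hanti (X a) (hder a)
      have hGP : (curvField G y + s • (1 : Matrix (Fin 3) (Fin 3) ℝ))ᵀ * G y
          = G y * (curvField G y + s • (1 : Matrix (Fin 3) (Fin 3) ℝ)) := by
        rw [Matrix.transpose_add, Matrix.add_mul, hGA, Matrix.mul_add]
        simp
      rw [← Matrix.mul_assoc, hGP, Matrix.mul_assoc, Matrix.mul_assoc, ← Matrix.mul_add, e,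
        Matrix.mul_zero])
    intro a
    have := hHX a
    rw [hT0 a, Matrix.mul_zero] at this
    exact this.symm
  have hcomm := hG.curvMat_commute hA (fun y hy a => by
    rw [← sub_eq_zero, ← hpar y hy a]
    abel) hx
  exact eq_smul_one_of_soliton hc (h1 x hx) (h2 x hx)
    (quadratic_of_commute_curvature (hG.inv_mul hx) (hG.symm x hx) (hG.mul_curvField_symm hx)
      (fun a b k l => hG.riemann_eq_kulkarni hx a b k l) hcomm)

theorem riemann_of_sectional {K : ℝ} (hx : x ∈ U)
    (h : ∀ v w : Fin 3 → ℝ,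
      ∑ i, ∑ j, ∑ k, ∑ l, riemann G i j k l x * v i * w j * w k * v l
        = K * ((∑ i, ∑ j, G x i j * v i * v j) * (∑ i, ∑ j, G x i j * w i * w j)
          - (∑ i, ∑ j, G x i j * v i * w j) ^ 2)) (i j k l : Fin 3) :
    riemann G i j k l x = K * (G x i l * G x j k - G x i k * G x j l) := by
  rw [← sub_eq_zero]
  refine eq_zero_of_sectional_eq_zero
    (R := fun i j k l => riemann G i j k l x - K * (G x i l * G x j k - G x i k * G x j l))
    (fun i j k l => ?_) (fun i j k l => ?_) (fun i j k l => ?_) (fun v w => ?_) i j k l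
  · rw [riemann_swap_left]
    ring
  · rw [hG.riemann_swap_right hx]
    ring
  · rw [hG.riemann_pair_symm hx, hG.apply_comm hx k j, hG.apply_comm hx l i, hG.apply_comm hx k i,
      hG.apply_comm hx l j]
    ring
  · have hs := hG.apply_comm hx
    have e : ∑ i, ∑ j, ∑ k, ∑ l,
        (riemann G i j k l x - K * (G x i l * G x j k - G x i k * G x j l))
          * v i * w j * w k * v l
        = ∑ i, ∑ j, ∑ k, ∑ l, riemann G i j k l x * v i * w j * w k * v l
          - K * ∑ i, ∑ j, ∑ k, ∑ l,
            (G x i l * G x j k - G x i k * G x j l) * v i * w j * w k * v l := by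
      simp only [Finset.mul_sum, ← Finset.sum_sub_distrib]
      refine Finset.sum_congr rfl fun a _ => Finset.sum_congr rfl fun b _ =>
        Finset.sum_congr rfl fun i _ => Finset.sum_congr rfl fun j _ => ?_
      ring
    rw [e, h]
    simp only [Fin.sum_univ_three, hs 1 0, hs 2 0, hs 2 1]
    ring

theorem sectional_of_riemann {K : ℝ} (hx : x ∈ U)
    (h : ∀ i j k l, riemann G i j k l x = K * (G x i l * G x j k - G x i k * G x j l))
    (v w : Fin 3 → ℝ) :
    ∑ i, ∑ j, ∑ k, ∑ l, riemann G i j k l x * v i * w j * w k * v l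
      = K * ((∑ i, ∑ j, G x i j * v i * v j) * (∑ i, ∑ j, G x i j * w i * w j)
          - (∑ i, ∑ j, G x i j * v i * w j) ^ 2) := by
  have hs := hG.apply_comm hx
  simp only [h, Fin.sum_univ_three, hs 1 0, hs 2 0, hs 2 1]
  ring

/-- The Ricci tensor is `2K g`, and `gA = (tr A) g - Ric` recovers `A` once the trace is known. -/
theorem curvField_of_riemann {K : ℝ} (hx : x ∈ U)
    (h : ∀ i j k l, riemann G i j k l x = K * (G x i l * G x j k - G x i k * G x j l)) :
    curvField G x = K • 1 := by
  have hδ : ∀ a l, ∑ b, (G x)⁻¹ a b * G x b l = if a = l then 1 else 0 := by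
    intro a l
    rw [← Matrix.mul_apply, hG.inv_mul hx, Matrix.one_apply]
  have hs := hG.apply_comm hx
  have hric : ∀ j k, ricci G j k x = 2 * K * G x j k := by
    intro j k
    have e : ricci G j k x = K * ((∑ a, ∑ b, (G x)⁻¹ a b * G x b a) * G x j k
        - ∑ a, G x a k * ∑ b, (G x)⁻¹ a b * G x b j) := by
      simp only [ricci, inv, h, Fin.sum_univ_three, hs j 0, hs j 1, hs j 2, hs 1 0, hs 2 0, hs 2 1]
      ring
    rw [e]
    simp only [hδ, if_true, mul_ite, mul_one, mul_zero, Finset.sum_ite_eq', Finset.mem_univ]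
    simp
    ring
  have e0 : curvField G x
      = ((curvField G x).trace - 2 * K) • (1 : Matrix (Fin 3) (Fin 3) ℝ) := by
    have e : G x * curvField G x
        = G x * (((curvField G x).trace - 2 * K) • (1 : Matrix (Fin 3) (Fin 3) ℝ)) := by
      ext i j
      have h1 := hric i j
      rw [hG.ricci_eq hx] at h1
      simp only [Matrix.mul_smul, Matrix.mul_one, Matrix.smul_apply, smul_eq_mul]
      linarith
    have := congrArg (fun X => (G x)⁻¹ * X) e
    simpa only [← Matrix.mul_assoc, hG.inv_mul hx, Matrix.one_mul] using this
  have et := congrArg Matrix.trace e0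
  simp [Matrix.trace_smul] at et
  rw [e0]
  congr 1
  linarith

/-- The curvature is parallel, so its divergence drops out and `R(grad f) = 0` remains; tracing that
gives `2K df = 0`. -/
theorem pd_eq_zero_of_constant_curvature {K : ℝ} (hK : K ≠ 0) {f : E3 → ℝ}
    (h : ∀ y ∈ U, ∀ i j k l, riemann G i j k l y = K * (G y i l * G y j k - G y i k * G y j l))
    (hym : ∀ j k l, codiffRiemann G j k l x + riemannGrad G f j k l x = 0) (hx : x ∈ U)
    (l : Fin 3) : pd l f x = 0 := by
  have hS : SmoothEntries (fun y => (K / 2) • G y) U :=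
    SmoothEntries.smul contDiffOn_const hG.smooth
  have hn : ∀ a, nablaMat G (fun y => (K / 2) • G y) a x = 0 := by
    intro a
    rw [nablaMat, matPd_const_smul hG.isOpen hG.smooth hx, hG.matPd_metric hx]
    simp only [smul_add, Matrix.smul_mul, Matrix.mul_smul]
    abel
  have hδ : ∀ a l, ∑ b, (G x)⁻¹ a b * G x b l = if a = l then 1 else 0 := by
    intro a l
    rw [← Matrix.mul_apply, hG.inv_mul hx, Matrix.one_apply]
  have hs := hG.apply_comm hx
  have key : ∀ j k l, K * (pd l f x * G x j k - pd k f x * G x j l) = 0 := by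
    intro j k l
    have e := hym j k l
    simp only [codiffRiemann, hG.nablaRiemann_eq_kulkarni hS
      (fun y hy i j k l => by rw [h y hy, kulkarni_smul_self]) hx, hn] at e
    have e2 : riemannGrad G f j k l x
        = K * ((∑ a, pd a f x * ∑ b, (G x)⁻¹ a b * G x b l) * G x j k
          - (∑ a, pd a f x * ∑ b, (G x)⁻¹ a b * G x b k) * G x j l) := by
      simp only [riemannGrad, inv, h x hx, Fin.sum_univ_three]
      ring
    simp only [hδ, mul_ite, mul_one, mul_zero, Finset.sum_ite_eq', Finset.mem_univ, if_true] at e2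
    rw [← e2]
    simpa [kulkarni] using e
  have e3 : ∑ j, ∑ k, (G x)⁻¹ j k * (pd l f x * G x j k - pd k f x * G x j l)
      = pd l f x * (∑ j, ∑ k, (G x)⁻¹ j k * G x k j)
        - ∑ k, pd k f x * ∑ j, (G x)⁻¹ k j * G x j l := by
    have hi : ∀ i j, (G x)⁻¹ i j = (G x)⁻¹ j i :=
      fun i j => congrFun (congrFun (hG.inv_symm hx) j) i
    simp only [Fin.sum_univ_three, hs 1 0, hs 2 0, hs 2 1, hi 1 0, hi 2 0, hi 2 1]
    ring
  have key' : ∀ j k, pd l f x * G x j k - pd k f x * G x j l = 0 := fun j k =>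
    (mul_eq_zero.1 (key j k l)).resolve_left hK
  simp only [key', hδ, mul_ite, mul_one, mul_zero, Finset.sum_ite_eq', Finset.mem_univ,
    if_true] at e3
  simp at e3
  linarith

/-- On a product `∂_0` is parallel, so `R(∂_0, ∂_j)∂_0 = 0`, whereas constant curvature gives
`R_{010l} = -K G_{1l}`. A whole row of `G` would vanish. -/
theorem not_product_of_constant_curvature {K : ℝ} (hK : K ≠ 0) (hx : x ∈ U)
    (h : ∀ i j k l, riemann G i j k l x = K * (G x i l * G x j k - G x i k * G x j l))
    (hp : ∀ y ∈ U, G y 0 0 = 1 ∧ G y 0 1 = 0 ∧ G y 0 2 = 0 ∧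
      ∀ i j, pd 0 (fun z => G z i j) y = 0) : False := by
  have hrow : ∀ y ∈ U, ∀ i j, pd i (fun z => G z 0 j) y = 0 := by
    intro y hy i j
    have hcon : ∃ c, Set.EqOn (fun z => G z 0 j) (fun _ => c) U := by
      fin_cases j
      · exact ⟨1, fun z hz => (hp z hz).1⟩
      · exact ⟨0, fun z hz => (hp z hz).2.1⟩
      · exact ⟨0, fun z hz => (hp z hz).2.2.1⟩
    obtain ⟨c, hc⟩ := hcon
    rw [pd_congr hG.isOpen hc hy, pd_const]
  have hΓ : ∀ y ∈ U, ∀ k j, christoffel G k 0 j y = 0 := by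
    intro y hy k j
    simp only [christoffel, (hp y hy).2.2.2, hrow y hy]
    simp
  have hΓ' : ∀ y ∈ U, ∀ k j, christoffel G k j 0 y = 0 := fun y hy k j => by
    rw [hG.christoffel_comm hy, hΓ y hy]
  have hup : ∀ l j, riemannUp G l 0 j 0 x = 0 := by
    intro l j
    rw [riemannUp, pd_congr (h := fun _ => 0) hG.isOpen (fun y hy => hΓ' y hy l j) hx,
      pd_congr (h := fun _ => 0) hG.isOpen (fun y hy => hΓ y hy l 0) hx, pd_const, pd_const]
    simp [hΓ x hx]
  have hR : ∀ j l, riemann G 0 j 0 l x = 0 := fun j l => by simp [riemann, hup]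
  obtain ⟨h00, h01, h02, -⟩ := hp x hx
  have hz : ∀ l, G x 1 l = 0 := by
    intro l
    have e := h 0 1 0 l
    rw [hR, hG.apply_comm hx 1 0, h01, h00] at e
    have := mul_eq_zero.1 e.symm |>.resolve_left hK
    linarith
  exact hG.det_ne_zero x hx (Matrix.det_eq_zero_of_row_eq_zero 1 hz)

end IsMetricOn

end Local

/-! ### From charts to the manifold -/

section Global

variable {M : Type*} [TopologicalSpace M] [ChartedSpace E3 M] [IsManifold (𝓡 3) ∞ M]

theorem isMetricOn_coeff (g : Metric M) {e : OpenPartialHomeomorph M E3}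
    (he : e ∈ smoothCharts M) : IsMetricOn (coeff g e) e.target where
  isOpen := e.open_target
  smooth := contDiffOn_coeff g he
  symm := fun x _ => coeff_symm g e x
  det_ne_zero := fun _ hx => det_coeff_ne_zero g he hx

theorem hessian_eq_zero_of_pd {G : E3 → Matrix (Fin 3) (Fin 3) ℝ} {f : E3 → ℝ} {U : Set E3}
    (hU : IsOpen U) (hf : ∀ y ∈ U, ∀ i, pd i f y = 0) {x : E3} (hx : x ∈ U) (i j : Fin 3) :
    hessian G f i j x = 0 := by
  rw [hessian, pd_congr (h := fun _ => 0) hU (fun y hy => hf y hy j) hx, pd_const]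
  simp [hf x hx]

theorem curvField_of_isConstant {κ c : ℝ} {g : Metric M} {φ : M → ℝ}
    (hsol : IsTorsionlessSoliton κ g φ) (hc : ∀ p, φ p = c) {e : OpenPartialHomeomorph M E3}
    (he : e ∈ smoothCharts M) {x : E3} (hx : x ∈ e.target) :
    curvField (coeff g e) x = (-Real.exp (2 * c) / 12) • 1 ∧ κ * Real.exp (2 * c) = 48 := by
  have hG := isMetricOn_coeff g he
  have hφ : φ ∘ e.symm = fun _ => c := funext fun y => hc _
  have hpd : ∀ y ∈ e.target, ∀ i, pd i (fun _ : E3 => c) y = 0 := fun y _ i => pd_const c i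
  refine hG.curvField_of_constant_dilaton (Real.exp_ne_zero _) (fun y hy i j => ?_)
    (fun y hy j k l => ?_) (fun y hy => ?_) hx
  · have := hsol.einstein e he y hy i j
    rwa [hφ, hessian_eq_zero_of_pd e.open_target hpd hy, hc, add_zero] at this
  · have := hsol.yangMills e he y hy j k l
    rw [hφ] at this
    simpa [riemannGrad, pd_const] using this
  · have := hsol.dilaton e he y hy
    rw [hφ, hc] at this
    simp only [codiffGrad, gradNormSq, hessian_eq_zero_of_pd e.open_target hpd hy, pd_const] at this
    simp at this
    linarith

theorem riemann_of_isConstant {κ c : ℝ} {g : Metric M} {φ : M → ℝ}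
    (hsol : IsTorsionlessSoliton κ g φ) (hc : ∀ p, φ p = c) {e : OpenPartialHomeomorph M E3}
    (he : e ∈ smoothCharts M) {x : E3} (hx : x ∈ e.target) (i j k l : Fin 3) :
    riemann (coeff g e) i j k l x = (-Real.exp (2 * c) / 12) *
      (coeff g e x i l * coeff g e x j k - coeff g e x i k * coeff g e x j l) := by
  rw [(isMetricOn_coeff g he).riemann_eq_kulkarni hx, (curvField_of_isConstant hsol hc he hx).1,
    ← kulkarni_smul_self]
  congr 1
  rw [Matrix.mul_smul, Matrix.mul_one, ← sub_smul]
  congr 1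
  simp [Matrix.trace_smul]
  ring

theorem isConstant_of_isHyperbolic {κ : ℝ} {g : Metric M} {φ : M → ℝ}
    (hsol : IsTorsionlessSoliton κ g φ) (hyp : IsHyperbolic g) : IsConstant φ := by
  obtain ⟨K, hK, hsec⟩ := hyp
  -- The dilaton equation with `dφ = 0` and `A = K` reads `3κK² = e^{2φ}`. This gives the same value
  -- at every point, without any appeal to connectedness.
  refine ⟨Real.log (κ * (3 * K ^ 2)) / 2, fun p => ?_⟩
  have he : chartAt E3 p ∈ smoothCharts M := IsManifold.chart_mem_maximalAtlas p
  set e := chartAt E3 p with hee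
  have hp : p ∈ e.source := mem_chart_source E3 p
  have hx : e p ∈ e.target := e.map_source hp
  have hG := isMetricOn_coeff g he
  have hR : ∀ y ∈ e.target, ∀ i j k l, riemann (coeff g e) i j k l y
      = K * (coeff g e y i l * coeff g e y j k - coeff g e y i k * coeff g e y j l) :=
    fun y hy => hG.riemann_of_sectional hy (hsec e he y hy)
  have hpd : ∀ y ∈ e.target, ∀ i, pd i (φ ∘ e.symm) y = 0 := fun y hy =>
    hG.pd_eq_zero_of_constant_curvature hK.ne hR (hsol.yangMills e he y hy) hy
  have hd := hsol.dilaton e he (e p) hx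
  rw [hG.riemannNormSq_eq hx, hG.curvField_of_riemann hx (hR _ hx), e.left_inv hp] at hd
  simp only [codiffGrad, gradNormSq, hessian_eq_zero_of_pd e.open_target hpd hx, hpd _ hx] at hd
  simp [Matrix.trace_smul] at hd
  have : κ * (3 * K ^ 2) = Real.exp (2 * φ p) := by linarith
  rw [this, Real.log_exp]
  ring

end Global

end Heterotic

theorem mainTheorem4 {M : Type*} [TopologicalSpace M] [ChartedSpace Heterotic.E3 M]
    [IsManifold (𝓡 3) ∞ M] [T2Space M] [CompactSpace M]
    (κ : ℝ) (g : Heterotic.Metric M) (φ : M → ℝ)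
    (hsol : Heterotic.IsTorsionlessSoliton κ g φ) (hflat : ¬ Heterotic.IsFlat g) :
    (Heterotic.IsConstant φ ↔ Heterotic.IsHyperbolic g) ∧
    (Heterotic.IsConstant φ →
      Heterotic.IsEinstein g ∧
      (∀ e ∈ Heterotic.smoothCharts M, ∀ x ∈ e.target,
        κ * Heterotic.scalarCurvature (Heterotic.coeff g e) x = -24) ∧
      (∀ p : M, κ * Real.exp (2 * φ p) = 48) ∧
      (∀ p : M, ¬ Heterotic.IsLocalProductAt g p)) := by
  refine ⟨⟨?_, Heterotic.isConstant_of_isHyperbolic hsol⟩, ?_⟩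
  · rintro ⟨c, hc⟩
    refine ⟨-Real.exp (2 * c) / 12, by linarith [Real.exp_pos (2 * c)], fun e he x hx => ?_⟩
    exact (Heterotic.isMetricOn_coeff g he).sectional_of_riemann hx
      (Heterotic.riemann_of_isConstant hsol hc he hx)
  · rintro ⟨c, hc⟩
    -- With `K = -e^{2c}/12`, the Einstein constant is `2K` and the scalar curvature is `6K`.
    refine ⟨⟨-Real.exp (2 * c) / 6, fun e he x hx i j => ?_⟩, fun e he x hx => ?_, fun p => ?_, ?_⟩
    · rw [(Heterotic.isMetricOn_coeff g he).ricci_eq hx,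
        (Heterotic.curvField_of_isConstant hsol hc he hx).1]
      simp [Matrix.trace_smul]
      ring
    · obtain ⟨h1, h2⟩ := Heterotic.curvField_of_isConstant hsol hc he hx
      rw [(Heterotic.isMetricOn_coeff g he).scalarCurvature_eq hx, h1]
      simp [Matrix.trace_smul]
      linarith
    · rw [hc]
      exact (Heterotic.curvField_of_isConstant hsol hc (IsManifold.chart_mem_maximalAtlas p)
        ((chartAt Heterotic.E3 p).map_source (mem_chart_source _ p))).2
    · rintro p ⟨e, he, hp, hprod⟩
      have hx := e.map_source hp
      exact (Heterotic.isMetricOn_coeff g he).not_product_of_constant_curvature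
        (div_ne_zero (neg_ne_zero.2 (Real.exp_ne_zero (2 * c))) (by norm_num)) hx
        (Heterotic.riemann_of_isConstant hsol hc he hx) hprod
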